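/- Let $\mathcal P=\langle\Sigma\mid\mathcal R\rangle$ be a semigroup presentation, where $\mathcal R$ is a set of pairs of non-empty words over $\Sigma$ such that $(u,v)\in\mathcal R$ implies $(v,u)\notin\mathcal R$, and let $w$ be a non-empty word over $\Sigma$. Semigroup diagrams over $\mathcal P$ are considered up to isotopy. Write $\epsilon(w)$ for the trivial diagram, $\Delta_1\circ\Delta_2$ for concatenation, $\Delta_1+\Delta_2$ for the sum, and $\Delta_1\cdot\Delta_2$ for the reduced form of $\Delta_1\circ\Delta_2$ (all dipoles removed). Write $\Delta\le D$ if $\Delta$ is a prefix of $D$, i.e. $D=\Delta\circ\Gamma$ for some diagram $\Gamma$; suffixes are defined similarly. A diagram is atomic if it has exactly one cell, and thin if it is trivial or a sum of atomic diagrams. The Farley complex $X=X(\mathcal P,w)$ is the cube complex whose vertices are the reduced diagrams with top path labelled by $w$ and whose $n$-cubes are spanned by the sets $\{\Delta\cdot P\mid P\le\Gamma\}$, where $\Delta$ is a vertex and $\Gamma$ is a thin diagram with $n$ cells such that $\Delta\circ\Gamma$ is defined; in particular, two vertices are joined by an edge if and only if one of them is the product $\cdot$ of the other with an atomic diagram.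 A hyperplane $J$ of $X$ is a class of the equivalence relation on the edges generated by being parallel sides of a square; its halfspaces are the connected components of the union of the cubes not crossed by $J$, and halfspaces are identified with their sets of vertices. A reduced diagram $\Delta$ with top path labelled by $w$ is minimal if its maximal thin suffix $F$ (the thin suffix of which every thin suffix of $\Delta$ is a suffix) has exactly one cell; then put $\overline\Delta=\Delta\cdot F^{-1}$. 1. For every hyperplane $J$ of $X$ there is a unique minimal diagram $\Delta$ such that $J$ has exactly one halfspace $J^+$ not containing $\epsilon(w)$ and $J^+=\{D\text{ vertex of }X\mid\Delta\le D\}$. 2. Conversely, if $\Delta$ is a minimal diagram, then $\Delta$ and $\overline\Delta$ are joined by an edge of $X$, and the hyperplane $J$ dual to (i.e. containing) the edge $[\Delta,\overline\Delta]$ has exactly one halfspace $J^+$ not containing $\epsilon(w)$, namely $J^+=\{D\text{ vertex of }X\mid\Delta\le D\}$. 3. Consequently, $J\mapsto\Delta$ is a bijection from the set of hyperplanes of $X$ onto the set of minimal diagrams. -/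

import Mathlib

/-- A semigroup presentation `⟨α ∣ R⟩`. Words are lists of letters; the two sides of a relation are
non-empty words, and if `u = v` is a relation then `v = u` is not one. -/
structure SemigroupPresentation (α : Type*) where
  rels : Set (List α × List α)
  ne_nil : ∀ {u v : List α}, (u, v) ∈ rels → u ≠ [] ∧ v ≠ []
  asymm : ∀ {u v : List α}, (u, v) ∈ rels → (v, u) ∉ rels

namespace SemigroupPresentation

variable {α : Type*}

/-- There is a `(u, v)`-cell over `P`: `u = v` or `v = u` is a relation. -/
def IsCell (P : SemigroupPresentation α) (u v : List α) : Prop :=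
  (u, v) ∈ P.rels ∨ (v, u) ∈ P.rels

theorem IsCell.symm {P : SemigroupPresentation α} {u v : List α} (h : P.IsCell u v) :
    P.IsCell v u := Or.symm h

/-- An elementary step `(left, src → tgt, right)` of a derivation, which replaces the subword `src`
of the word `left src right` by `tgt`. -/
@[ext]
structure Step (α : Type*) where
  left : List α
  src : List α
  tgt : List α
  right : List α

namespace Step

def top (s : Step α) : List α := s.left ++ s.src ++ s.right

def bot (s : Step α) : List α := s.left ++ s.tgt ++ s.right

/-- The step `(left, tgt → src, right)`. -/
def inv (s : Step α) : Step α := ⟨s.left, s.tgt, s.src, s.right⟩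

/-- The step `(x left, src → tgt, right y)`. -/
def whisker (x y : List α) (s : Step α) : Step α := ⟨x ++ s.left, s.src, s.tgt, s.right ++ y⟩

end Step

/-- `P.IsDerivation u l v`: the list of steps `l` is a derivation over `P` from `u` to `v`. -/
def IsDerivation (P : SemigroupPresentation α) : List α → List (Step α) → List α → Prop
  | u, [], v => u = v
  | u, s :: l, v => P.IsCell s.src s.tgt ∧ s.top = u ∧ IsDerivation P s.bot l v

theorem IsDerivation.append {P : SemigroupPresentation α} {l l' : List (Step α)} :
    ∀ {u v w : List α}, P.IsDerivation u l v → P.IsDerivation v l' w →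
      P.IsDerivation u (l ++ l') w := by
  induction l with
  | nil => intro u v w h h'; cases h; exact h'
  | cons s l ih => intro u v w h h'; exact ⟨h.1, h.2.1, ih h.2.2 h'⟩

theorem IsDerivation.inv {P : SemigroupPresentation α} {l : List (Step α)} :
    ∀ {u v : List α}, P.IsDerivation u l v → P.IsDerivation v (l.map Step.inv).reverse u := by
  induction l with
  | nil => intro u v h; exact Eq.symm h
  | cons s l ih =>
    intro u v h
    rw [List.map_cons, List.reverse_cons]
    exact (ih h.2.2).append ⟨h.1.symm, rfl, h.2.1⟩

theorem IsDerivation.whisker {P : SemigroupPresentation α} (x y : List α) {l : List (Step α)} :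
    ∀ {u v : List α}, P.IsDerivation u l v →
      P.IsDerivation (x ++ u ++ y) (l.map (Step.whisker x y)) (x ++ v ++ y) := by
  induction l with
  | nil => intro u v h; cases h; rfl
  | cons s l ih =>
    intro u v h
    refine ⟨h.1, ?_, ?_⟩
    · rw [← h.2.1]; simp [Step.whisker, Step.top]
    · have := ih h.2.2
      simpa [Step.whisker, Step.bot] using this

/-- Two consecutive steps that rewrite disjoint subwords `u`, `u'` of the word `a u b u' c` are
performed in the other order. -/
inductive Exchange : List (Step α) → List (Step α) → Prop
  | mk (l₁ l₂ : List (Step α)) (a u v b u' v' c : List α) :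
      Exchange
        (l₁ ++ ⟨a, u, v, b ++ u' ++ c⟩ :: ⟨a ++ v ++ b, u', v', c⟩ :: l₂)
        (l₁ ++ ⟨a ++ u ++ b, u', v', c⟩ :: ⟨a, u, v, b ++ v' ++ c⟩ :: l₂)

theorem Exchange.append_left (l : List (Step α)) {l₁ l₂ : List (Step α)} (h : Exchange l₁ l₂) :
    Exchange (l ++ l₁) (l ++ l₂) := by
  obtain ⟨m, n, a, u, v, b, u', v', c⟩ := h
  simpa only [List.append_assoc] using Exchange.mk (l ++ m) n a u v b u' v' c

theorem Exchange.append_right (l : List (Step α)) {l₁ l₂ : List (Step α)} (h : Exchange l₁ l₂) :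
    Exchange (l₁ ++ l) (l₂ ++ l) := by
  obtain ⟨m, n, a, u, v, b, u', v', c⟩ := h
  simpa only [List.append_assoc, List.cons_append] using Exchange.mk m (n ++ l) a u v b u' v' c

theorem Exchange.whisker (x y : List α) {l₁ l₂ : List (Step α)} (h : Exchange l₁ l₂) :
    Exchange (l₁.map (Step.whisker x y)) (l₂.map (Step.whisker x y)) := by
  obtain ⟨m, n, a, u, v, b, u', v', c⟩ := h
  simpa [Step.whisker] using Exchange.mk (m.map (Step.whisker x y)) (n.map (Step.whisker x y))
    (x ++ a) u v b u' v' (c ++ y)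

theorem Exchange.inv {l₁ l₂ : List (Step α)} (h : Exchange l₁ l₂) :
    Exchange (l₂.map Step.inv).reverse (l₁.map Step.inv).reverse := by
  obtain ⟨m, n, a, u, v, b, u', v', c⟩ := h
  simpa [Step.inv] using Exchange.mk (n.map Step.inv).reverse (m.map Step.inv).reverse
    a v u b v' u' c

theorem Exchange.length_eq {l₁ l₂ : List (Step α)} (h : Exchange l₁ l₂) :
    l₁.length = l₂.length := by
  obtain ⟨m, n, a, u, v, b, u', v', c⟩ := h
  simp

/-- The `(u, v)`-diagrams over `P`, up to isotopy. A derivation from `u` to `v` describes the plane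
diagram obtained from the path labelled by `u` by gluing the cells of its steps, one after the
other, below the current bottom path. Every diagram arises in this way, and two derivations describe
isotopic diagrams if and only if they differ by exchanges of consecutive steps whose cells have no
edge in common. -/
def Diagram (P : SemigroupPresentation α) (u v : List α) : Type _ :=
  Quot fun d d' : {l : List (Step α) // P.IsDerivation u l v} => Exchange d.1 d'.1

namespace Diagram

variable {P : SemigroupPresentation α}

/-- The trivial diagram `ε(w)`, without cells. -/
def trivial (P : SemigroupPresentation α) (w : List α) : P.Diagram w w := Quot.mk _ ⟨[], rfl⟩

/-- The diagram `ε(p) + π + ε(q)`, where `π` is a single `(a, b)`-cell. -/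
def cell (p q : List α) {a b : List α} (h : P.IsCell a b) :
    P.Diagram (p ++ a ++ q) (p ++ b ++ q) :=
  Quot.mk _ ⟨[⟨p, a, b, q⟩], h, rfl, rfl⟩

/-- The number of cells. -/
def numCells {u v : List α} (Δ : P.Diagram u v) : ℕ :=
  Quot.lift (fun d => d.1.length) (fun _ _ h => h.length_eq) Δ

/-- The concatenation `Δ₁ ∘ Δ₂`: the bottom path of `Δ₁` is identified with the top path of
`Δ₂`. -/
def comp {u v w : List α} (Δ₁ : P.Diagram u v) (Δ₂ : P.Diagram v w) : P.Diagram u w :=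
  Quot.map₂ (fun d d' => ⟨d.1 ++ d'.1, d.2.append d'.2⟩)
    (fun _ _ _ h => h.append_left _) (fun _ _ _ h => h.append_right _) Δ₁ Δ₂

/-- The sum `Δ₁ + Δ₂`: `Δ₂` is placed to the right of `Δ₁`. -/
def sum {u v u' v' : List α} (Δ₁ : P.Diagram u v) (Δ₂ : P.Diagram u' v') :
    P.Diagram (u ++ u') (v ++ v') :=
  Quot.map₂
    (fun d d' => ⟨d.1.map (Step.whisker [] u') ++ d'.1.map (Step.whisker v []), by
      have h := d.2.whisker [] u'
      have h' := d'.2.whisker v []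
      simp only [List.nil_append, List.append_nil] at h h'
      exact h.append h'⟩)
    (fun _ _ _ h => (h.whisker _ _).append_left _)
    (fun _ _ _ h => (h.whisker _ _).append_right _) Δ₁ Δ₂

/-- The mirror image `Δ⁻¹`. -/
def inv {u v : List α} (Δ : P.Diagram u v) : P.Diagram v u :=
  Quot.lift (fun d => Quot.mk _ ⟨(d.1.map Step.inv).reverse, d.2.inv⟩)
    (fun _ _ h => (Quot.sound h.inv).symm) Δ

theorem numCells_comp {u v w : List α} (Δ₁ : P.Diagram u v) (Δ₂ : P.Diagram v w) :
    (Δ₁.comp Δ₂).numCells = Δ₁.numCells + Δ₂.numCells := by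
  induction Δ₁ using Quot.ind with | mk d =>
  induction Δ₂ using Quot.ind with | mk d' => exact List.length_append

/-- `Δ₁ ≤ Δ₂`: `Δ₁` is a prefix of `Δ₂`. -/
def IsPrefix {u v w : List α} (Δ₁ : P.Diagram u v) (Δ₂ : P.Diagram u w) : Prop :=
  ∃ Δ₃ : P.Diagram v w, Δ₂ = Δ₁.comp Δ₃

/-- `Δ₁` is a suffix of `Δ₂`. -/
def IsSuffix {u v w : List α} (Δ₁ : P.Diagram v w) (Δ₂ : P.Diagram u w) : Prop :=
  ∃ Δ₃ : P.Diagram u v, Δ₂ = Δ₃.comp Δ₁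

/-- An atomic diagram has exactly one cell. -/
def IsAtomic {u v : List α} (Δ : P.Diagram u v) : Prop := Δ.numCells = 1

/-- A diagram is thin if it is a sum of atomic diagrams; trivial diagrams are the thin diagrams
without cells. (A sum of an atomic and a trivial diagram is atomic.) -/
inductive IsThin : ∀ {u v : List α}, P.Diagram u v → Prop
  | trivial (w : List α) : IsThin (trivial P w)
  | sum {u v u' v' : List α} (A : P.Diagram u v) (Γ : P.Diagram u' v') :
      A.IsAtomic → IsThin Γ → IsThin (A.sum Γ)

/-- `F` is the maximal thin suffix of `Δ`: it is a thin suffix of which every thin suffix of `Δ` is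
a suffix. -/
def IsMaximalThinSuffix {u v w : List α} (F : P.Diagram v w) (Δ : P.Diagram u w) : Prop :=
  F.IsThin ∧ F.IsSuffix Δ ∧
    ∀ (v' : List α) (F' : P.Diagram v' w), F'.IsThin → F'.IsSuffix Δ → F'.IsSuffix F

/-- The maximal thin suffix of `Δ` has exactly one cell. -/
def IsMinimal {u w : List α} (Δ : P.Diagram u w) : Prop :=
  ∃ (v : List α) (F : P.Diagram v w), F.IsMaximalThinSuffix Δ ∧ F.numCells = 1

/-- `Δ'` is obtained from `Δ` by reducing a dipole, i.e. an `(a, b)`-cell and a `(b, a)`-cell such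
that the bottom path of the former is the top path of the latter. -/
def ReducesDipole {u v : List α} (Δ Δ' : P.Diagram u v) : Prop :=
  ∃ (p a b q : List α) (h : P.IsCell a b)
    (A : P.Diagram u (p ++ a ++ q)) (B : P.Diagram (p ++ a ++ q) v),
    Δ = A.comp ((cell p q h).comp ((cell p q h.symm).comp B)) ∧ Δ' = A.comp B

/-- A diagram is reduced if it does not contain dipoles. -/
def IsReduced {u v : List α} (Δ : P.Diagram u v) : Prop := ∀ Δ' : P.Diagram u v, ¬ Δ.ReducesDipole Δ'

/-- `R` is the reduced form of `Δ`: it is reduced and obtained from `Δ` by reducing dipoles. -/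
def IsReducedForm {u v : List α} (Δ R : P.Diagram u v) : Prop :=
  R.IsReduced ∧ Relation.ReflTransGen ReducesDipole Δ R

theorem isReduced_trivial (P : SemigroupPresentation α) (w : List α) :
    (trivial P w).IsReduced := by
  rintro Δ' ⟨p, a, b, q, h, A, B, h₁, -⟩
  have h₂ := congrArg numCells h₁
  rw [numCells_comp, numCells_comp] at h₂
  have h₃ : (trivial P w).numCells = 0 := rfl
  have h₄ : (cell p q h).numCells = 1 := rfl
  omega

end Diagram

/-- The vertices of the Farley complex `X(P, w)`: the reduced diagrams with top path labelled by
`w`. -/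
structure FarleyVertex (P : SemigroupPresentation α) (w : List α) where
  bot : List α
  diagram : P.Diagram w bot
  isReduced : diagram.IsReduced

variable {P : SemigroupPresentation α} {w : List α}

namespace FarleyVertex

/-- The vertex `ε(w)`. -/
def base (P : SemigroupPresentation α) (w : List α) : P.FarleyVertex w :=
  ⟨w, Diagram.trivial P w, Diagram.isReduced_trivial P w⟩

/-- `E = D · Γ`, i.e. the vertex `E` is the reduced form of `D ∘ Γ`. -/
def IsProduct (D : P.FarleyVertex w) {x : List α} (Γ : P.Diagram D.bot x)
    (E : P.FarleyVertex w) : Prop :=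
  ∃ (R : P.Diagram w x) (h : (D.diagram.comp Γ).IsReducedForm R), E = ⟨x, R, h.1⟩

/-- The set of the vertices of `X(P, w)` that have `Δ` as a prefix. -/
def prefixCone (Δ : P.FarleyVertex w) : Set (P.FarleyVertex w) :=
  {D | Δ.diagram.IsPrefix D.diagram}

end FarleyVertex

/-- The `1`-skeleton of `X(P, w)`: two vertices are joined by an edge if one is the product of the
other with an atomic diagram. -/
def farleyGraph (P : SemigroupPresentation α) (w : List α) : SimpleGraph (P.FarleyVertex w) :=
  SimpleGraph.fromRel fun D E =>
    ∃ (x : List α) (A : P.Diagram D.bot x), A.IsAtomic ∧ D.IsProduct A E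

/-- `S` is the set of vertices of an `n`-cube of `X(P, w)`, i.e. it is the set of the products
`D · Q`, where `Q` ranges over the prefixes of a thin diagram `Γ` with `n` cells. -/
def IsCube (n : ℕ) (S : Set (P.FarleyVertex w)) : Prop :=
  ∃ (D : P.FarleyVertex w) (y : List α) (Γ : P.Diagram D.bot y), Γ.IsThin ∧ Γ.numCells = n ∧
    S = {E | ∃ (x : List α) (Q : P.Diagram D.bot x), Q.IsPrefix Γ ∧ D.IsProduct Q E}

/-- The edges `e` and `f` are parallel sides of a square of `X(P, w)`: they join vertices of the
square and have no endpoint in common. -/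
def AreParallelSides (e f : (farleyGraph P w).edgeSet) : Prop :=
  ∃ S : Set (P.FarleyVertex w), IsCube 2 S ∧ (∀ D ∈ e.1, D ∈ S) ∧ (∀ D ∈ f.1, D ∈ S) ∧
    ∀ D ∈ e.1, D ∉ f.1

/-- The hyperplanes of `X(P, w)`: the classes of the equivalence relation on the edges that is
generated by being parallel sides of a square. -/
def Hyperplane (P : SemigroupPresentation α) (w : List α) : Type _ :=
  Quot (AreParallelSides (P := P) (w := w))

namespace Hyperplane

/-- The hyperplane dual to an edge. -/
def dual (e : (farleyGraph P w).edgeSet) : Hyperplane P w := Quot.mk _ e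

/-- The set of the edges that belong to the hyperplane. -/
def edges (J : Hyperplane P w) : Set (Sym2 (P.FarleyVertex w)) :=
  {e | ∃ h : e ∈ (farleyGraph P w).edgeSet, dual ⟨e, h⟩ = J}

/-- `S` is the set of vertices of a halfspace of `J`, i.e. of a connected component of the
subcomplex `X \\ J` that consists of the cubes not crossed by `J`. The `1`-skeleton of this
subcomplex is obtained from that of `X(P, w)` by deleting the edges in `J`. -/
def IsHalfspace (J : Hyperplane P w) (S : Set (P.FarleyVertex w)) : Prop :=
  ∃ c : ((farleyGraph P w).deleteEdges J.edges).ConnectedComponent, S = c.supp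

/-- `S` is the halfspace `J⁺`: it is the one and only halfspace of `J` that does not contain
`ε(w)`. -/
def IsPositiveHalfspace (J : Hyperplane P w) (S : Set (P.FarleyVertex w)) : Prop :=
  ∀ T : Set (P.FarleyVertex w), (J.IsHalfspace T ∧ FarleyVertex.base P w ∉ T) ↔ T = S

end Hyperplane

end SemigroupPresentation

/-!
A diagram over `P` is drawn on the path labelled by `w` by gluing cells from below. Recording for
every edge of the drawing the cell that created it, edges and cells carry their whole history, so
that isotopic derivations draw the same edges and a diagram is determined by its bottom path, or
equally by its set of cells. Reduced diagrams are those in which no cell is glued to the bottom path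
of its mirror image, and multiplying with an atomic diagram either glues one more cell or removes
an exposed one. Hence an edge of `X(P, w)` is the gluing of a single cell.

Opposite sides of a square glue the same cell. Conversely, an edge that glues `c` to obtain `E` can
be moved across squares by removing the exposed cells of `E` other than `c`, until `c` is the only
exposed cell. There is only one diagram containing `c` with this property, and it is minimal. So
hyperplanes correspond to cells that occur in reduced diagrams, these correspond to minimal
diagrams, and the halfspace `J⁺` consists of the diagrams that contain `c`.
-/

namespace SemigroupPresentation

variable {α : Type*} {P : SemigroupPresentation α} {w : List α}

/-! ### Edges, paths and cells -/

/-- An edge of a diagram, described by its history: it is the `i`-th edge of the top path, or the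
`j`-th edge of the bottom path, labelled by `v`, of a cell with top path `t`. In both cases `a` is
the label of the edge. -/
inductive PathEdge (α : Type*) where
  | init (i : ℕ) (a : α)
  | out (t : List (PathEdge α)) (v : List α) (j : ℕ) (a : α)

/-- A path in a diagram, as the list of its edges from left to right. -/
abbrev EdgePath (α : Type*) := List (PathEdge α)

namespace PathEdge

/-- The letter that labels an edge. -/
def label : PathEdge α → α
  | init _ a => a
  | out _ _ _ a => a

/-- The position of an edge in the top path of the diagram, or in the bottom path of the cell above
it. -/
def index : PathEdge α → ℕ
  | init i _ => i
  | out _ _ j _ => j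

end PathEdge

/-- The word read along a path. -/
def labels (S : EdgePath α) : List α := S.map PathEdge.label

@[simp] theorem labels_append (S T : EdgePath α) : labels (S ++ T) = labels S ++ labels T :=
  List.map_append

@[simp] theorem length_labels (S : EdgePath α) : (labels S).length = S.length := List.length_map _

theorem labels_eq_nil {S : EdgePath α} : labels S = [] ↔ S = [] := List.map_eq_nil_iff

theorem exists_eq_append_of_labels_eq {S : EdgePath α} {u v : List α} (h : labels S = u ++ v) :
    ∃ x y, S = x ++ y ∧ labels x = u ∧ labels y = v :=
  List.map_eq_append_iff.1 h

/-- The top path of a diagram with top label `w`. -/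
def initPath (w : List α) : EdgePath α := w.zipIdx.map fun p => .init p.2 p.1

@[simp] theorem labels_initPath (w : List α) : labels (initPath w) = w := by
  simp [labels, initPath, Function.comp_def, PathEdge.label]

theorem exists_eq_init_of_mem_initPath {e : PathEdge α} (h : e ∈ initPath w) :
    ∃ i a, e = .init i a := by
  obtain ⟨p, -, rfl⟩ := List.mem_map.1 h
  exact ⟨_, _, rfl⟩

theorem nodup_initPath (w : List α) : (initPath w).Nodup := by
  refine List.Nodup.of_map PathEdge.index ?_
  simp [initPath, Function.comp_def, PathEdge.index, List.zipIdx_map_snd, List.nodup_range']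

/-- A cell of a diagram, described by its top path and the label of its bottom path. -/
structure PathCell (α : Type*) where
  top : EdgePath α
  botLabel : List α

namespace PathCell

/-- The bottom path of a cell. -/
def bot (c : PathCell α) : EdgePath α :=
  c.botLabel.zipIdx.map fun p => .out c.top c.botLabel p.2 p.1

@[simp] theorem labels_bot (c : PathCell α) : labels c.bot = c.botLabel := by
  simp [labels, bot, Function.comp_def, PathEdge.label]

theorem bot_ne_nil {c : PathCell α} : c.bot ≠ [] ↔ c.botLabel ≠ [] := by
  rw [← labels_bot, Ne, Ne, labels_eq_nil]

theorem exists_eq_out_of_mem_bot {c : PathCell α} {e : PathEdge α} (h : e ∈ c.bot) :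
    ∃ j a, e = .out c.top c.botLabel j a := by
  obtain ⟨p, -, rfl⟩ := List.mem_map.1 h
  exact ⟨_, _, rfl⟩

theorem nodup_bot (c : PathCell α) : c.bot.Nodup := by
  refine List.Nodup.of_map PathEdge.index ?_
  simp [bot, Function.comp_def, PathEdge.index, List.zipIdx_map_snd, List.nodup_range']

theorem eq_of_mem_bot {c d : PathCell α} {e : PathEdge α} (hc : e ∈ c.bot) (hd : e ∈ d.bot) :
    c = d := by
  obtain ⟨j, a, rfl⟩ := exists_eq_out_of_mem_bot hc
  obtain ⟨k, b, h⟩ := exists_eq_out_of_mem_bot hd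
  cases c
  cases d
  cases h
  rfl

theorem eq_of_bot_eq {c d : PathCell α} (hc : c.bot ≠ []) (h : c.bot = d.bot) : c = d :=
  have ⟨_, he⟩ := List.exists_mem_of_ne_nil _ hc
  eq_of_mem_bot he (h ▸ he)

/-- The step of a derivation that glues `c` below the path `x c.top y`. -/
def step (c : PathCell α) (x y : EdgePath α) : Step α :=
  ⟨labels x, labels c.top, c.botLabel, labels y⟩

/-- `c` is a cell over `P`. -/
def IsOver (P : SemigroupPresentation α) (c : PathCell α) : Prop :=
  P.IsCell (labels c.top) c.botLabel

end PathCell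

theorem IsCell.ne_nil {u v : List α} (h : P.IsCell u v) : u ≠ [] ∧ v ≠ [] :=
  h.elim P.ne_nil fun h => (P.ne_nil h).symm

namespace PathCell

theorem IsOver.top_ne_nil {c : PathCell α} (h : c.IsOver P) : c.top ≠ [] :=
  mt labels_eq_nil.2 (IsCell.ne_nil h).1

theorem IsOver.bot_ne_nil {c : PathCell α} (h : c.IsOver P) : c.bot ≠ [] :=
  PathCell.bot_ne_nil.2 (IsCell.ne_nil h).2

theorem IsOver.isDerivation_step {c : PathCell α} (h : c.IsOver P) (x y : EdgePath α) :
    P.IsDerivation (labels (x ++ c.top ++ y)) [c.step x y] (labels (x ++ c.bot ++ y)) :=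
  ⟨h, by simp [step, Step.top], by simp [step, Step.bot, IsDerivation]⟩

end PathCell

section Lists

variable {β : Type*}

theorem overlap_or_exists_eq_append {m y a m' y' : List β} (hm' : m' ≠ [])
    (h : m ++ y = a ++ (m' ++ y')) :
    (∃ e ∈ m, e ∈ m') ∨ ∃ z, a = m ++ z ∧ y = z ++ m' ++ y' := by
  rcases List.append_eq_append_iff.1 h with ⟨b, rfl, rfl⟩ | ⟨b, rfl, hb⟩
  · exact .inr ⟨b, rfl, by simp⟩
  · rcases b with _ | ⟨e, b⟩
    · exact .inr ⟨[], by simp, by simpa using hb.symm⟩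
    · obtain ⟨e', m', rfl⟩ := List.exists_cons_of_ne_nil hm'
      obtain ⟨rfl, -⟩ : e' = e ∧ m' ++ y' = b ++ y := by simpa using hb
      exact .inl ⟨e', by simp, by simp⟩

theorem segment_trichotomy {x m y x' m' y' : List β} (hm : m ≠ []) (hm' : m' ≠ [])
    (h : x ++ m ++ y = x' ++ m' ++ y') :
    (∃ e ∈ m, e ∈ m') ∨ (∃ z, x' = x ++ m ++ z ∧ y = z ++ m' ++ y') ∨
      ∃ z, x = x' ++ m' ++ z ∧ y' = z ++ m ++ y := by
  rw [List.append_assoc, List.append_assoc] at h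
  rcases List.append_eq_append_iff.1 h with ⟨a, rfl, hy⟩ | ⟨a, rfl, hy⟩
  · rcases overlap_or_exists_eq_append hm' hy with hmm' | ⟨z, rfl, hz⟩
    · exact .inl hmm'
    · exact .inr (.inl ⟨z, by simp, hz⟩)
  · rcases overlap_or_exists_eq_append hm hy with ⟨e, he, he'⟩ | ⟨z, rfl, hz⟩
    · exact .inl ⟨e, he', he⟩
    · exact .inr (.inr ⟨z, by simp, hz⟩)

theorem append_inj_of_nodup {x m y x' y' : List β} (hm : m ≠ []) (hn : (x ++ m ++ y).Nodup)
    (h : x ++ m ++ y = x' ++ m ++ y') : x = x' ∧ y = y' := by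
  obtain ⟨e, m, rfl⟩ := List.exists_cons_of_ne_nil hm
  simp only [List.append_assoc, List.cons_append] at h hn
  have hnotMem := (List.nodup_cons.1 (List.nodup_middle.1 hn)).1
  rw [List.mem_append, not_or] at hnotMem
  obtain ⟨rfl, -, h⟩ := (List.append_cons_inj_of_notMem hnotMem.1 hnotMem.2).1 h
  exact ⟨rfl, List.append_cancel_left h⟩

end Lists

/-! ### Derivations and diagrams acting on paths -/

/-- The action of a step on a path: if `c` is the cell with bottom label `s.tgt` that the step `s`
glues below the path, then the segment `c.top` becomes `f c`. -/
def act (f : PathCell α → EdgePath α) (S : EdgePath α) (s : Step α) : EdgePath α :=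
  S.take s.left.length ++ f ⟨(S.drop s.left.length).take s.src.length, s.tgt⟩ ++
    S.drop (s.left.length + s.src.length)

/-- The action of a list of steps on a path. -/
def run (f : PathCell α → EdgePath α) (S : EdgePath α) (l : List (Step α)) : EdgePath α :=
  l.foldl (act f) S

theorem exists_eq_step {S : EdgePath α} {s : Step α} (h : labels S = s.top) :
    ∃ c x y, S = x ++ PathCell.top c ++ y ∧ s = c.step x y := by
  obtain ⟨xm, y, rfl, hxm, hy⟩ := exists_eq_append_of_labels_eq h
  obtain ⟨x, m, rfl, hx, hm⟩ := exists_eq_append_of_labels_eq hxm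
  exact ⟨⟨m, s.tgt⟩, x, y, rfl, Step.ext hx.symm hm.symm rfl hy.symm⟩

theorem IsDerivation.of_append {l l' : List (Step α)} {u v : List α}
    (h : P.IsDerivation u (l ++ l') v) : ∃ m, P.IsDerivation u l m ∧ P.IsDerivation m l' v := by
  induction l generalizing u with
  | nil => exact ⟨u, rfl, h⟩
  | cons s l ih =>
    obtain ⟨m, hl, hl'⟩ := ih h.2.2
    exact ⟨m, ⟨h.1, h.2.1, hl⟩, hl'⟩

section Run

variable {f : PathCell α → EdgePath α}

@[simp] theorem run_nil (S : EdgePath α) : run f S [] = S := rfl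

@[simp] theorem run_cons (S : EdgePath α) (s : Step α) (l : List (Step α)) :
    run f S (s :: l) = run f (act f S s) l := rfl

@[simp] theorem run_append (S : EdgePath α) (l l' : List (Step α)) :
    run f S (l ++ l') = run f (run f S l) l' := List.foldl_append

theorem act_append {x y : EdgePath α} {c : PathCell α} {u v : List α} (hx : labels x = u) :
    act f (x ++ c.top ++ y) ⟨u, labels c.top, c.botLabel, v⟩ = x ++ f c ++ y := by
  subst hx
  simp [act]

theorem act_step (x y : EdgePath α) (c : PathCell α) :
    act f (x ++ c.top ++ y) (c.step x y) = x ++ f c ++ y := act_append rfl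

theorem run_induction (hf : ∀ c, labels (f c) = c.botLabel) {p : EdgePath α → Prop}
    (hp : ∀ c x y, PathCell.IsOver P c → p (x ++ c.top ++ y) → p (x ++ f c ++ y))
    {S : EdgePath α} {l : List (Step α)} {u v : List α} (hl : P.IsDerivation u l v)
    (hS : labels S = u) (h : p S) : p (run f S l) := by
  induction l generalizing S u with
  | nil => exact h
  | cons s l ih =>
    obtain ⟨c, x, y, rfl, rfl⟩ := exists_eq_step (hS.trans hl.2.1.symm)
    rw [run_cons, act_step]
    exact ih hl.2.2 (by simp [hf, PathCell.step, Step.bot]) (hp c x y hl.1 h)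

theorem labels_run (hf : ∀ c, labels (f c) = c.botLabel) {S : EdgePath α} {l : List (Step α)}
    {u v : List α} (hl : P.IsDerivation u l v) (hS : labels S = u) : labels (run f S l) = v := by
  induction l generalizing S u with
  | nil => exact hS.trans hl
  | cons s l ih =>
    obtain ⟨c, x, y, rfl, rfl⟩ := exists_eq_step (hS.trans hl.2.1.symm)
    rw [run_cons, act_step]
    exact ih hl.2.2 (by simp [hf, PathCell.step, Step.bot])

theorem exists_eq_append_cells {S : EdgePath α} {a p b p' r : List α}
    (h : labels S = a ++ p ++ (b ++ p' ++ r)) (q q' : List α) :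
    ∃ (c d : PathCell α) (x z y : EdgePath α), S = x ++ c.top ++ z ++ d.top ++ y ∧
      labels x = a ∧ labels c.top = p ∧ c.botLabel = q ∧ labels z = b ∧ labels d.top = p' ∧
        d.botLabel = q' ∧ labels y = r := by
  obtain ⟨xm, zny, rfl, hxm, hzny⟩ := exists_eq_append_of_labels_eq h
  obtain ⟨x, m, rfl, hx, hm⟩ := exists_eq_append_of_labels_eq hxm
  obtain ⟨zn, y, rfl, hzn, hy⟩ := exists_eq_append_of_labels_eq hzny
  obtain ⟨z, n, rfl, hz, hn⟩ := exists_eq_append_of_labels_eq hzn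
  exact ⟨⟨m, q⟩, ⟨n, q'⟩, x, z, y, by simp, hx, hm, rfl, hz, hn, rfl, hy⟩

theorem act_act_left_right (hf : ∀ c, labels (f c) = c.botLabel) (c d : PathCell α)
    (x z y : EdgePath α) :
    act f (act f (x ++ c.top ++ z ++ d.top ++ y) (c.step x (z ++ d.top ++ y)))
      (d.step (x ++ c.bot ++ z) y) = x ++ f c ++ z ++ f d ++ y := by
  have h := act_step (f := f) x (z ++ d.top ++ y) c
  simp only [← List.append_assoc] at h
  rw [h]
  exact act_append (by simp [hf])

theorem act_act_right_left (c d : PathCell α) (x z y : EdgePath α) :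
    act f (act f (x ++ c.top ++ z ++ d.top ++ y) (d.step (x ++ c.top ++ z) y))
      (c.step x (z ++ d.bot ++ y)) = x ++ f c ++ z ++ f d ++ y := by
  rw [act_step]
  simpa only [List.append_assoc, PathCell.step] using
    act_append (f := f) (x := x) (y := z ++ f d ++ y) (c := c) rfl

theorem run_exchange (hf : ∀ c, labels (f c) = c.botLabel) {S : EdgePath α} {l l' : List (Step α)}
    {u v : List α} (hl : Exchange l l') (h : P.IsDerivation u l v) (hS : labels S = u) :
    run f S l = run f S l' := by
  obtain ⟨l₁, l₂, a, p, q, b, p', q', r⟩ := hl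
  obtain ⟨m, h₁, h₂⟩ := h.of_append
  obtain ⟨c, d, x, z, y, hT, rfl, rfl, rfl, rfl, rfl, rfl, rfl⟩ :=
    exists_eq_append_cells ((labels_run hf h₁ hS).trans h₂.2.1.symm) q q'
  simp only [run_append, run_cons, hT]
  congr 1
  simpa [PathCell.step] using
    (act_act_left_right hf c d x z y).trans (act_act_right_left c d x z y).symm

end Run

theorem Exchange.isDerivation_iff {l l' : List (Step α)} (hl : Exchange l l') {u v : List α} :
    P.IsDerivation u l v ↔ P.IsDerivation u l' v := by
  obtain ⟨l₁, l₂, a, p, q, b, p', q', c⟩ := hl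
  constructor <;> intro h
  all_goals
    obtain ⟨m, h₁, h₂, htop, h₃, -, h₄⟩ := h.of_append
    refine h₁.append ⟨h₃, ?_, h₂, ?_, ?_⟩
    · simpa [Step.top] using htop
    · simp [Step.top, Step.bot]
    · simpa [Step.bot] using h₄

/-- The derivations `l` and `l'` differ by exchanges. -/
def Isotopic (l l' : List (Step α)) : Prop := Quot.mk Exchange l = Quot.mk Exchange l'

theorem Isotopic.symm {l l' : List (Step α)} (h : Isotopic l l') : Isotopic l' l := Eq.symm h

theorem Isotopic.trans {l l' l'' : List (Step α)} (h : Isotopic l l') (h' : Isotopic l' l'') :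
    Isotopic l l'' := Eq.trans h h'

theorem Isotopic.isDerivation_iff {l l' : List (Step α)} (hl : Isotopic l l') {u v : List α} :
    P.IsDerivation u l v ↔ P.IsDerivation u l' v :=
  Iff.of_eq <| congrArg (Quot.lift (fun k => P.IsDerivation u k v)
    fun _ _ h => propext h.isDerivation_iff) hl

theorem Isotopic.append_right {l l' : List (Step α)} (hl : Isotopic l l') (k : List (Step α)) :
    Isotopic (l ++ k) (l' ++ k) :=
  congrArg (Quot.map (· ++ k) fun _ _ => Exchange.append_right k) hl

theorem Isotopic.append_left {l l' : List (Step α)} (hl : Isotopic l l') (k : List (Step α)) :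
    Isotopic (k ++ l) (k ++ l') :=
  congrArg (Quot.map (k ++ ·) fun _ _ => Exchange.append_left k) hl

theorem isotopic_step_swap (c d : PathCell α) (x z y : EdgePath α) :
    Isotopic [c.step x (z ++ d.top ++ y), d.step (x ++ c.bot ++ z) y]
      [d.step (x ++ c.top ++ z) y, c.step x (z ++ d.bot ++ y)] := by
  simpa [PathCell.step, Isotopic] using Quot.sound (Exchange.mk [] [] (labels x) (labels c.top)
    c.botLabel (labels z) (labels d.top) d.botLabel (labels y))

namespace Diagram

/-- The diagram described by a derivation. -/
def ofDerivation {u v : List α} {l : List (Step α)} (h : P.IsDerivation u l v) : P.Diagram u v :=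
  Quot.mk _ ⟨l, h⟩

theorem exists_eq_ofDerivation {u v : List α} (Δ : P.Diagram u v) :
    ∃ (l : List (Step α)) (h : P.IsDerivation u l v), Δ = ofDerivation h := by
  induction Δ using Quot.ind with | mk d => exact ⟨d.1, d.2, rfl⟩

theorem ofDerivation_eq_iff {u v : List α} {l l' : List (Step α)} {h : P.IsDerivation u l v}
    {h' : P.IsDerivation u l' v} : ofDerivation h = ofDerivation h' ↔ Isotopic l l' := by
  refine ⟨congrArg (Quot.map Subtype.val fun _ _ h => h), fun hl => ?_⟩
  replace hl : Relation.EqvGen Exchange l l' := Quot.eqvGen_exact hl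
  induction hl with
  | rel _ _ hl => exact Quot.sound hl
  | refl => rfl
  | symm _ _ _ ih => exact ih.symm
  | trans k m n hkm _ ih ih' =>
    exact (ih (h' := (Isotopic.isDerivation_iff (Quot.eqvGen_sound hkm)).1 h)).trans ih'

theorem numCells_ofDerivation {u v : List α} {l : List (Step α)} (h : P.IsDerivation u l v) :
    (ofDerivation h).numCells = l.length := rfl

theorem comp_assoc {u v x y : List α} (Δ₁ : P.Diagram u v) (Δ₂ : P.Diagram v x)
    (Δ₃ : P.Diagram x y) : (Δ₁.comp Δ₂).comp Δ₃ = Δ₁.comp (Δ₂.comp Δ₃) := by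
  obtain ⟨l₁, h₁, rfl⟩ := Δ₁.exists_eq_ofDerivation
  obtain ⟨l₂, h₂, rfl⟩ := Δ₂.exists_eq_ofDerivation
  obtain ⟨l₃, h₃, rfl⟩ := Δ₃.exists_eq_ofDerivation
  exact ofDerivation_eq_iff.2 (congrArg _ (List.append_assoc l₁ l₂ l₃))

theorem comp_trivial {u v : List α} (Δ : P.Diagram u v) : Δ.comp (trivial P v) = Δ := by
  obtain ⟨l, h, rfl⟩ := Δ.exists_eq_ofDerivation
  exact ofDerivation_eq_iff.2 (congrArg _ (List.append_nil l))

theorem trivial_comp {u v : List α} (Δ : P.Diagram u v) : (trivial P u).comp Δ = Δ := by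
  obtain ⟨l, h, rfl⟩ := Δ.exists_eq_ofDerivation
  rfl

section Run

variable {f : PathCell α → EdgePath α}

/-- The action of a diagram on a path labelled by its top label. -/
def run (hf : ∀ c, labels (f c) = c.botLabel) {u v : List α} (S : EdgePath α) (hS : labels S = u)
    (Δ : P.Diagram u v) : EdgePath α :=
  Quot.lift (fun d : {l : List (Step α) // P.IsDerivation u l v} =>
    SemigroupPresentation.run f S d.1) (fun d _ h => run_exchange hf h d.2 hS) Δ

theorem labels_run (hf : ∀ c, labels (f c) = c.botLabel) {u v : List α} {S : EdgePath α}
    (hS : labels S = u) (Δ : P.Diagram u v) : labels (Δ.run hf S hS) = v := by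
  obtain ⟨l, h, rfl⟩ := Δ.exists_eq_ofDerivation
  exact SemigroupPresentation.labels_run hf h hS

theorem run_comp (hf : ∀ c, labels (f c) = c.botLabel) {u v x : List α} {S : EdgePath α}
    (hS : labels S = u) (Δ : P.Diagram u v) (Δ' : P.Diagram v x) :
    (Δ.comp Δ').run hf S hS = Δ'.run hf (Δ.run hf S hS) (labels_run hf hS Δ) := by
  obtain ⟨l, h, rfl⟩ := Δ.exists_eq_ofDerivation
  obtain ⟨l', h', rfl⟩ := Δ'.exists_eq_ofDerivation
  exact run_append S l l'

end Run

end Diagram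

/-! ### Cells above a path -/

/-- `c.IsAbove e`: the cell `c` belongs to the history of the edge `e`. -/
inductive PathCell.IsAbove (c : PathCell α) : PathEdge α → Prop
  | of_mem_bot {e : PathEdge α} : e ∈ c.bot → c.IsAbove e
  | of_mem_top {d : PathCell α} {e' e : PathEdge α} :
      c.IsAbove e' → e' ∈ d.top → e ∈ d.bot → c.IsAbove e

/-- The cells of a diagram with bottom path `S`. -/
def cells (S : EdgePath α) : Set (PathCell α) := {c | ∃ e ∈ S, c.IsAbove e}

@[simp] theorem cells_initPath : cells (initPath w) = ∅ := by
  refine Set.eq_empty_of_forall_notMem fun c ⟨e, he, hc⟩ => ?_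
  obtain ⟨i, a, rfl⟩ := exists_eq_init_of_mem_initPath he
  obtain hc | ⟨-, -, hc⟩ := hc <;>
    obtain ⟨_, _, hc⟩ := PathCell.exists_eq_out_of_mem_bot hc <;> cases hc

@[simp] theorem cells_append (S T : EdgePath α) : cells (S ++ T) = cells S ∪ cells T := by
  ext c
  simp only [cells, Set.mem_ofPred_eq, Set.mem_union, List.mem_append, or_and_right, exists_or]

theorem mem_cells_of_mem_bot {S : EdgePath α} {c : PathCell α} {e : PathEdge α} (hc : e ∈ c.bot)
    (hS : e ∈ S) : c ∈ cells S :=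
  ⟨e, hS, .of_mem_bot hc⟩

theorem cells_top_subset_of_mem_cells {S : EdgePath α} {c : PathCell α} (hc : c ∈ cells S) :
    cells c.top ⊆ cells S := by
  obtain ⟨e, he, hc⟩ := hc
  rintro d ⟨e', he', hd⟩
  refine ⟨e, he, ?_⟩
  clear he
  induction hc with
  | of_mem_bot he => exact .of_mem_top hd he' he
  | of_mem_top _ htop hbot ih => exact .of_mem_top ih htop hbot

theorem cells_bot {c : PathCell α} (hc : c.bot ≠ []) : cells c.bot = insert c (cells c.top) := by
  obtain ⟨e, he⟩ := List.exists_mem_of_ne_nil _ hc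
  refine Set.Subset.antisymm ?_ (Set.insert_subset (mem_cells_of_mem_bot he he)
    (cells_top_subset_of_mem_cells (mem_cells_of_mem_bot he he)))
  rintro d ⟨e', he', hd | ⟨hd, htop, hbot⟩⟩
  · exact .inl (PathCell.eq_of_mem_bot hd he')
  · obtain rfl := PathCell.eq_of_mem_bot hbot he'
    exact .inr ⟨_, htop, hd⟩

/-- The path `S'` is obtained from `S` by gluing the cell `c` below `S`. -/
def Glues (P : SemigroupPresentation α) (c : PathCell α) (S S' : EdgePath α) : Prop :=
  c.IsOver P ∧ ∃ x y, S = x ++ c.top ++ y ∧ S' = x ++ c.bot ++ y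

/-- A path all of whose edges lie on the boundary of the diagram above it: it passes through no edge
twice, and through no edge that has a cell of the diagram below it. -/
structure IsSimple (S : EdgePath α) : Prop where
  nodup : S.Nodup
  disjoint_top : ∀ c ∈ cells S, c.top.Disjoint S

namespace Glues

variable {c : PathCell α} {S S' : EdgePath α}

theorem cells_eq (h : P.Glues c S S') : cells S' = insert c (cells S) := by
  obtain ⟨hc, x, y, rfl, rfl⟩ := h
  simp only [cells_append, cells_bot hc.bot_ne_nil, Set.insert_union, Set.union_insert]

theorem cells_top_subset (h : P.Glues c S S') : cells c.top ⊆ cells S := by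
  obtain ⟨-, x, y, rfl, -⟩ := h
  simp only [cells_append, Set.subset_union_of_subset_left Set.subset_union_right]

theorem notMem_cells (h : P.Glues c S S') (hS : IsSimple S) : c ∉ cells S := by
  obtain ⟨hc, x, y, rfl, rfl⟩ := h
  obtain ⟨e, he⟩ := List.exists_mem_of_ne_nil _ hc.top_ne_nil
  exact fun hcS => hS.disjoint_top c hcS he (by simp [he])

theorem notMem_cells_top (h : P.Glues c S S') (hS : IsSimple S) {d : PathCell α}
    (hd : d ∈ cells S') : c ∉ cells d.top := by
  rw [h.cells_eq] at hd
  rcases hd with rfl | hd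
  · exact fun hc => h.notMem_cells hS (h.cells_top_subset hc)
  · exact fun hc => h.notMem_cells hS (cells_top_subset_of_mem_cells hd hc)

theorem isSimple (h : P.Glues c S S') (hS : IsSimple S) : IsSimple S' := by
  have hc := h.notMem_cells hS
  have hcells := h.cells_eq
  have hbelow {d : PathCell α} : d ∈ cells S' → c ∉ cells d.top := h.notMem_cells_top hS
  obtain ⟨-, x, y, rfl, rfl⟩ := h
  have hperm (m : EdgePath α) : (x ++ m ++ y).Perm (x ++ y ++ m) := by
    simpa only [List.append_assoc] using List.perm_append_comm.append_left x
  obtain ⟨hnodup, hdisjoint⟩ := hS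
  rw [(hperm _).nodup_iff, List.nodup_append'] at hnodup
  refine ⟨?_, fun d hd e he heS => ?_⟩
  · rw [(hperm _).nodup_iff, List.nodup_append']
    refine ⟨hnodup.1, c.nodup_bot, fun e he hec => hc ?_⟩
    exact mem_cells_of_mem_bot hec ((hperm _).mem_iff.2 (List.mem_append_left _ he))
  · rcases List.mem_append.1 ((hperm _).mem_iff.1 heS) with hexy | hec
    · rcases hcells ▸ hd with rfl | hd
      · exact hnodup.2.2 hexy he
      · exact hdisjoint d hd he ((hperm _).mem_iff.2 (List.mem_append_left _ hexy))
    · exact hbelow hd (mem_cells_of_mem_bot hec he)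

theorem right_unique {T : EdgePath α} (h : P.Glues c S S') (h' : P.Glues c S T)
    (hS : IsSimple S) : S' = T := by
  obtain ⟨hc, x, y, rfl, rfl⟩ := h
  obtain ⟨-, x', y', hS', rfl⟩ := h'
  obtain ⟨rfl, rfl⟩ := append_inj_of_nodup hc.top_ne_nil hS.nodup hS'
  rfl

end Glues

/-- `S` is the bottom path of a diagram over `P` with top label `w`. -/
inductive IsBotPath (P : SemigroupPresentation α) (w : List α) : EdgePath α → Prop
  | init : IsBotPath P w (initPath w)
  | glue {c : PathCell α} {S S' : EdgePath α} :
      IsBotPath P w S → P.Glues c S S' → IsBotPath P w S'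

theorem IsBotPath.isSimple {S : EdgePath α} (hS : P.IsBotPath w S) : IsSimple S := by
  induction hS with
  | init => exact ⟨nodup_initPath w, by simp⟩
  | glue _ hglue ih => exact hglue.isSimple ih

theorem isBotPath_run {l : List (Step α)} {v : List α} (hl : P.IsDerivation w l v) :
    P.IsBotPath w (run PathCell.bot (initPath w) l) :=
  run_induction PathCell.labels_bot (fun _ x y hc h => h.glue ⟨hc, x, y, rfl, rfl⟩) hl
    (labels_initPath w) .init

theorem IsBotPath.exists_derivation {S : EdgePath α} (hS : P.IsBotPath w S) :
    ∃ l, P.IsDerivation w l (labels S) ∧ run PathCell.bot (initPath w) l = S := by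
  induction hS with
  | init => exact ⟨[], (labels_initPath w).symm, rfl⟩
  | glue _ hglue ih =>
    obtain ⟨l, hl, hrun⟩ := ih
    obtain ⟨hc, x, y, rfl, rfl⟩ := hglue
    exact ⟨_, hl.append (hc.isDerivation_step x y), by
      rw [run_append, hrun, run_cons, run_nil, act_step]⟩

theorem IsDerivation.exists_last_step {f : PathCell α → EdgePath α}
    (hf : ∀ c, labels (f c) = c.botLabel) {l : List (Step α)} {s : Step α} {u v : List α}
    (h : P.IsDerivation u (l ++ [s]) v) {S : EdgePath α} (hS : labels S = u) :
    ∃ c x y, PathCell.IsOver P c ∧ s = c.step x y ∧ run f S l = x ++ c.top ++ y ∧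
      run f S (l ++ [s]) = x ++ f c ++ y ∧ P.IsDerivation u l (labels (x ++ c.top ++ y)) := by
  obtain ⟨m, hl, hs⟩ := h.of_append
  have hrun := labels_run hf hl hS
  obtain ⟨c, x, y, hxy, rfl⟩ := exists_eq_step (hrun.trans hs.2.1.symm)
  refine ⟨c, x, y, hs.1, rfl, hxy, ?_, by rwa [← hxy, hrun]⟩
  rw [run_append, hxy, run_cons, run_nil, act_step]

/-- Up to isotopy, the last step of the derivation `l` from `w` glues `c` below `x c.top y`. -/
def GluesLast (P : SemigroupPresentation α) (w : List α) (l : List (Step α)) (c : PathCell α)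
    (x y : EdgePath α) : Prop :=
  c.IsOver P ∧ ∃ l₀, P.IsDerivation w l₀ (labels (x ++ c.top ++ y)) ∧
    run PathCell.bot (initPath w) l₀ = x ++ c.top ++ y ∧ Isotopic l (l₀ ++ [c.step x y])

theorem GluesLast.append_step_right {l : List (Step α)} {c d : PathCell α} {x z y : EdgePath α}
    (h : P.GluesLast w l c x (z ++ d.top ++ y)) (hd : d.IsOver P) :
    P.GluesLast w (l ++ [d.step (x ++ c.bot ++ z) y]) c x (z ++ d.bot ++ y) := by
  obtain ⟨hc, l₀, hl₀, hrun, hiso⟩ := h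
  replace hl₀ : P.IsDerivation w l₀ (labels (x ++ c.top ++ z ++ d.top ++ y)) := by simpa using hl₀
  refine ⟨hc, l₀ ++ [d.step (x ++ c.top ++ z) y], ?_, ?_, (hiso.append_right _).trans ?_⟩
  · simpa using hl₀.append (hd.isDerivation_step (x ++ c.top ++ z) y)
  · have hact := act_step (f := PathCell.bot) (x ++ c.top ++ z) y d
    simpa [hrun] using hact
  · simpa using (isotopic_step_swap c d x z y).append_left l₀

theorem GluesLast.append_step_left {l : List (Step α)} {c d : PathCell α} {x z y : EdgePath α}
    (h : P.GluesLast w l c (x ++ d.top ++ z) y) (hd : d.IsOver P) :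
    P.GluesLast w (l ++ [d.step x (z ++ c.bot ++ y)]) c (x ++ d.bot ++ z) y := by
  obtain ⟨hc, l₀, hl₀, hrun, hiso⟩ := h
  replace hl₀ : P.IsDerivation w l₀ (labels (x ++ d.top ++ (z ++ c.top ++ y))) := by
    simpa using hl₀
  refine ⟨hc, l₀ ++ [d.step x (z ++ c.top ++ y)], ?_, ?_, (hiso.append_right _).trans ?_⟩
  · simpa using hl₀.append (hd.isDerivation_step x (z ++ c.top ++ y))
  · have hact := act_step (f := PathCell.bot) x (z ++ c.top ++ y) d
    simpa [hrun] using hact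
  · simpa using (isotopic_step_swap d c x z y).symm.append_left l₀

-- The cell `c` is the last cell, or it lies beside the last cell and can be exchanged with it.
theorem gluesLast_of_run_eq {l : List (Step α)} {v : List α} (hl : P.IsDerivation w l v)
    {c : PathCell α} {x y : EdgePath α} (hc : c.bot ≠ [])
    (h : run PathCell.bot (initPath w) l = x ++ c.bot ++ y) : P.GluesLast w l c x y := by
  induction l using List.reverseRecOn generalizing v x y with
  | nil =>
    obtain ⟨e, he⟩ := List.exists_mem_of_ne_nil _ hc
    have hcells : c ∈ cells (initPath w) :=
      mem_cells_of_mem_bot he (by rw [← run_nil (initPath w), h]; simp [he])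
    simp at hcells
  | append_singleton l s ih =>
    have hnodup := (isBotPath_run hl).isSimple.nodup
    obtain ⟨d, x', y', hd, rfl, hrun, hrun', hl'⟩ :=
      hl.exists_last_step PathCell.labels_bot (labels_initPath w)
    rw [h] at hrun' hnodup
    rcases segment_trichotomy hc hd.bot_ne_nil hrun' with
      ⟨e, he, he'⟩ | ⟨z, rfl, rfl⟩ | ⟨z, rfl, rfl⟩
    · obtain rfl := PathCell.eq_of_mem_bot he he'
      obtain ⟨rfl, rfl⟩ := append_inj_of_nodup hc hnodup hrun'
      exact ⟨hd, l, hl', hrun, rfl⟩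
    · exact (ih hl' (by simp [hrun])).append_step_right hd
    · exact (ih hl' (by simp [hrun])).append_step_left hd

theorem isotopic_of_run_eq {l l' : List (Step α)} {v v' : List α} (hl : P.IsDerivation w l v)
    (hl' : P.IsDerivation w l' v')
    (h : run PathCell.bot (initPath w) l = run PathCell.bot (initPath w) l') : Isotopic l l' := by
  induction l using List.reverseRecOn generalizing l' v v' with
  | nil =>
    rcases List.eq_nil_or_concat' l' with rfl | ⟨l', s, rfl⟩
    · rfl
    · obtain ⟨c, x, y, hc, -, -, hrun, -⟩ :=
        hl'.exists_last_step PathCell.labels_bot (labels_initPath w)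
      have hcells : c ∈ cells (initPath w) := by
        rw [← run_nil (initPath w), h, hrun]
        simp [cells_bot hc.bot_ne_nil]
      simp at hcells
  | append_singleton l s ih =>
    obtain ⟨c, x, y, hc, rfl, hrun, hrun', hl₀⟩ :=
      hl.exists_last_step PathCell.labels_bot (labels_initPath w)
    obtain ⟨-, l₀, hl₀', hrun₀, hiso⟩ :=
      gluesLast_of_run_eq hl' hc.bot_ne_nil (h.symm.trans hrun')
    exact ((ih hl₀ hl₀' (hrun.trans hrun₀.symm)).append_right _).trans hiso.symm

theorem IsBotPath.of_bot {c : PathCell α} {x y : EdgePath α}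
    (hS : P.IsBotPath w (x ++ c.bot ++ y)) (hc : c.bot ≠ []) :
    c.IsOver P ∧ P.IsBotPath w (x ++ c.top ++ y) := by
  obtain ⟨l, hl, hrun⟩ := hS.exists_derivation
  obtain ⟨hcP, l₀, hl₀, hrun₀, -⟩ := gluesLast_of_run_eq hl hc hrun
  exact ⟨hcP, hrun₀ ▸ isBotPath_run hl₀⟩

/-- The cell `c` has its bottom path on the path `S`, so that it can be removed from a diagram with
bottom path `S`. -/
def PathCell.IsExposed (c : PathCell α) (S : EdgePath α) : Prop := c.bot ≠ [] ∧ c.bot <:+: S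

namespace PathCell.IsExposed

variable {c : PathCell α} {S : EdgePath α}

theorem mem_cells (hc : c.IsExposed S) : c ∈ cells S :=
  have ⟨_, he⟩ := List.exists_mem_of_ne_nil _ hc.1
  mem_cells_of_mem_bot he (hc.2.subset he)

theorem exists_glues (hc : c.IsExposed S) (hS : P.IsBotPath w S) :
    ∃ S₀, P.IsBotPath w S₀ ∧ P.Glues c S₀ S := by
  obtain ⟨hne, x, y, rfl⟩ := hc
  obtain ⟨hcP, hS₀⟩ := hS.of_bot hne
  exact ⟨_, hS₀, hcP, x, y, rfl, rfl⟩

end PathCell.IsExposed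

theorem Glues.isExposed {c : PathCell α} {S S' : EdgePath α} (h : P.Glues c S S') :
    c.IsExposed S' := by
  obtain ⟨hc, x, y, -, rfl⟩ := h
  exact ⟨hc.bot_ne_nil, x, y, rfl⟩

theorem Glues.isExposed_or_mem_cells_top {c d : PathCell α} {S S' : EdgePath α}
    (h : P.Glues c S S') (hd : d.IsExposed S) : d.IsExposed S' ∨ d ∈ cells c.top := by
  obtain ⟨hc, x, y, rfl, rfl⟩ := h
  obtain ⟨hne, x', y', hS⟩ := hd
  rcases segment_trichotomy hne hc.top_ne_nil hS with ⟨e, he, he'⟩ | ⟨z, rfl, rfl⟩ | ⟨z, rfl, rfl⟩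
  · exact .inr (mem_cells_of_mem_bot he he')
  · exact .inl ⟨hne, x', z ++ c.bot ++ y, by simp⟩
  · exact .inl ⟨hne, x ++ c.bot ++ z, y', by simp⟩

theorem IsBotPath.exists_isExposed {S : EdgePath α} (hS : P.IsBotPath w S) {c : PathCell α}
    (hc : c ∈ cells S) : ∃ d : PathCell α, d.IsExposed S ∧ (c = d ∨ c ∈ cells d.top) := by
  induction hS with
  | init => simp at hc
  | @glue d S S' _ hglue ih =>
    by_cases hcd : c = d ∨ c ∈ cells d.top
    · exact ⟨d, hglue.isExposed, hcd⟩
    rw [hglue.cells_eq] at hc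
    obtain ⟨d', hd', hcd'⟩ := ih (hc.resolve_left fun h => hcd (.inl h))
    refine ⟨d', (hglue.isExposed_or_mem_cells_top hd').resolve_right fun h => hcd (.inr ?_), hcd'⟩
    rcases hcd' with rfl | hcd'
    exacts [h, cells_top_subset_of_mem_cells h hcd']

theorem IsBotPath.eq_of_cells_eq {S S' : EdgePath α} (hS : P.IsBotPath w S)
    (hS' : P.IsBotPath w S') (h : cells S = cells S') : S = S' := by
  induction hS generalizing S' with
  | init =>
    rcases hS' with _ | ⟨-, hglue⟩
    · rfl
    · exact absurd (h.symm.trans cells_initPath) (hglue.cells_eq ▸ Set.insert_nonempty _ _).ne_empty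
  | @glue c S₀ S hS₀ hglue ih =>
    obtain ⟨d, hd, hcd⟩ := hS'.exists_isExposed (h ▸ hglue.isExposed.mem_cells)
    obtain rfl : c = d :=
      hcd.resolve_right (hglue.notMem_cells_top hS₀.isSimple (h ▸ hd.mem_cells))
    obtain ⟨S₀', hS₀', hglue'⟩ := hd.exists_glues hS'
    have hcells : cells S₀ = cells S₀' := by
      rw [hglue.cells_eq, hglue'.cells_eq] at h
      rw [← Set.insert_sdiff_self_of_notMem (hglue.notMem_cells hS₀.isSimple), h,
        Set.insert_sdiff_self_of_notMem (hglue'.notMem_cells hS₀'.isSimple)]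
    obtain rfl := ih hS₀' hcells
    exact hglue.right_unique hglue' hS₀.isSimple

/-- The cell `c` is the only exposed cell of a diagram with bottom path `S`. -/
def IsTip (c : PathCell α) (S : EdgePath α) : Prop :=
  c ∈ cells S ∧ ∀ d : PathCell α, d.IsExposed S → d = c

namespace IsTip

variable {c : PathCell α} {S S' : EdgePath α}

theorem isExposed (h : IsTip c S) (hS : P.IsBotPath w S) : c.IsExposed S := by
  obtain ⟨d, hd, -⟩ := hS.exists_isExposed h.1
  exact h.2 d hd ▸ hd

theorem cells_eq (h : IsTip c S) (hS : P.IsBotPath w S) : cells S = insert c (cells c.top) := by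
  refine Set.Subset.antisymm (fun c' hc' => ?_)
    (Set.insert_subset h.1 (cells_top_subset_of_mem_cells h.1))
  obtain ⟨d, hd, hcd⟩ := hS.exists_isExposed hc'
  exact h.2 d hd ▸ hcd

theorem unique (h : IsTip c S) (h' : IsTip c S') (hS : P.IsBotPath w S)
    (hS' : P.IsBotPath w S') : S = S' :=
  hS.eq_of_cells_eq hS' ((h.cells_eq hS).trans (h'.cells_eq hS').symm)

end IsTip

/-! ### Dipoles -/

namespace PathCell

/-- The mirror image of the cell `d`, glued below `d`: the two cells form a dipole. -/
def inv (d : PathCell α) : PathCell α := ⟨d.bot, labels d.top⟩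

open Classical in
/-- The path that replaces `c.top` when `c` is glued below it and the dipole that may arise is
reduced. -/
noncomputable def toggle (c : PathCell α) : EdgePath α :=
  if h : ∃ d : PathCell α, c = d.inv then h.choose.top else c.bot

theorem toggle_cases (c : PathCell α) :
    (∃ d : PathCell α, c = d.inv ∧ c.toggle = d.top) ∨
      (∀ d : PathCell α, c ≠ d.inv) ∧ c.toggle = c.bot := by
  by_cases h : ∃ d : PathCell α, c = d.inv
  · exact .inl ⟨_, h.choose_spec, dif_pos h⟩
  · exact .inr ⟨not_exists.1 h, dif_neg h⟩

theorem toggle_inv {d : PathCell α} (hd : d.bot ≠ []) : d.inv.toggle = d.top := by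
  rcases d.inv.toggle_cases with ⟨d', hd', htoggle⟩ | ⟨h, -⟩
  · rw [htoggle, eq_of_bot_eq hd (congrArg top hd')]
  · exact absurd rfl (h d)

@[simp] theorem labels_toggle (c : PathCell α) : labels c.toggle = c.botLabel := by
  rcases c.toggle_cases with ⟨d, rfl, h⟩ | ⟨-, h⟩
  · rw [h, inv]
  · rw [h, labels_bot]

end PathCell

/-- No two cells of a diagram with bottom path `S` form a dipole. -/
def IsDipoleFree (S : EdgePath α) : Prop := ∀ d : PathCell α, d.inv ∉ cells S

theorem IsDipoleFree.mono {S T : EdgePath α} (hT : IsDipoleFree T) (h : cells S ⊆ cells T) :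
    IsDipoleFree S := fun d hd => hT d (h hd)

theorem IsDipoleFree.toggle_eq_bot {S : EdgePath α} {c : PathCell α} (hS : IsDipoleFree S)
    (hc : c ∈ cells S) : c.toggle = c.bot := by
  rcases c.toggle_cases with ⟨d, rfl, -⟩ | ⟨-, h⟩
  exacts [absurd hc (hS d), h]

theorem IsDipoleFree.toggle {c : PathCell α} (hc : c.IsOver P) {x y : EdgePath α}
    (h : IsDipoleFree (x ++ c.top ++ y)) : IsDipoleFree (x ++ c.toggle ++ y) := by
  rcases c.toggle_cases with ⟨d, rfl, htoggle⟩ | ⟨hinv, htoggle⟩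
  · refine h.mono ?_
    have hcells : cells d.top ⊆ cells d.inv.top :=
      (cells_bot hc.top_ne_nil).symm ▸ Set.subset_insert _ _
    simp only [htoggle, cells_append]
    gcongr
  · intro d hd
    rw [htoggle, Glues.cells_eq ⟨hc, x, y, rfl, rfl⟩] at hd
    exact hd.elim (fun hdc => hinv d hdc.symm) (h d)

theorem toggle_toggle {c : PathCell α} (hc : c.IsOver P) (h : IsDipoleFree c.top) :
    PathCell.toggle ⟨c.toggle, labels c.top⟩ = c.top := by
  rcases c.toggle_cases with ⟨d, rfl, htoggle⟩ | ⟨-, htoggle⟩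
  · have hd : d ∈ cells d.bot := (cells_bot hc.top_ne_nil).symm ▸ Set.mem_insert _ _
    rw [htoggle, PathCell.inv, PathCell.labels_bot]
    exact h.toggle_eq_bot hd
  · rw [htoggle]
    exact PathCell.toggle_inv hc.bot_ne_nil

theorem isDipoleFree_run_toggle {l : List (Step α)} {u v : List α} {S : EdgePath α}
    (hl : P.IsDerivation u l v) (hS : labels S = u) (h : IsDipoleFree S) :
    IsDipoleFree (run PathCell.toggle S l) :=
  run_induction PathCell.labels_toggle (fun _ _ _ hc h => h.toggle hc) hl hS h

theorem cells_subset_cells_run {l : List (Step α)} {u v : List α} {S : EdgePath α}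
    (hl : P.IsDerivation u l v) (hS : labels S = u) : cells S ⊆ cells (run PathCell.bot S l) := by
  refine run_induction (p := fun T => cells S ⊆ cells T) PathCell.labels_bot
    (fun c x y hc h => h.trans ?_) hl hS subset_rfl
  rw [Glues.cells_eq ⟨hc, x, y, rfl, rfl⟩]
  exact Set.subset_insert _ _

theorem act_act_inv {f : PathCell α → EdgePath α} (hf : ∀ c, labels (f c) = c.botLabel)
    (x y : EdgePath α) (c : PathCell α) :
    act f (act f (x ++ c.top ++ y) (c.step x y)) (c.step x y).inv =
      x ++ f ⟨f c, labels c.top⟩ ++ y := by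
  rw [act_step]
  simpa only [PathCell.step, Step.inv, hf] using
    act_append (f := f) (x := x) (y := y) (c := ⟨f c, labels c.top⟩) rfl

namespace Diagram

theorem ReducesDipole.exists_run_eq {f : PathCell α → EdgePath α}
    (hf : ∀ c, labels (f c) = c.botLabel) {u v : List α} {Δ Δ' : P.Diagram u v}
    (h : Δ.ReducesDipole Δ') {S : EdgePath α} (hS : labels S = u) :
    ∃ (c : PathCell α) (x y : EdgePath α) (t : List α) (A : P.Diagram u t)
      (l : List (Step α)), c.IsOver P ∧ P.IsDerivation (labels (x ++ c.top ++ y)) l v ∧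
        A.run hf S hS = x ++ c.top ++ y ∧ Δ'.run hf S hS = SemigroupPresentation.run f
          (x ++ c.top ++ y) l ∧ Δ.run hf S hS = SemigroupPresentation.run f
            (x ++ f ⟨f c, labels c.top⟩ ++ y) l := by
  obtain ⟨p, a, b, q, hc, A, B, rfl, rfl⟩ := h
  obtain ⟨l, hl, rfl⟩ := B.exists_eq_ofDerivation
  obtain ⟨c, x, y, hxy, hs⟩ := exists_eq_step (s := ⟨p, a, b, q⟩) (labels_run hf hS A)
  obtain ⟨rfl, rfl, rfl, rfl⟩ := Step.mk.injEq .. ▸ hs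
  refine ⟨c, x, y, _, A, l, hc, by simpa using hl, hxy, ?_, ?_⟩
  · rw [run_comp, ← hxy]
    rfl
  · rw [← act_act_inv hf, ← hxy]
    simp only [run_comp]
    rfl

theorem IsReduced.of_comp {u v x : List α} {Δ₁ : P.Diagram u v} {Δ₂ : P.Diagram v x}
    (h : (Δ₁.comp Δ₂).IsReduced) : Δ₁.IsReduced := by
  rintro Δ' ⟨p, a, b, q, hc, A, B, rfl, rfl⟩
  exact h _ ⟨p, a, b, q, hc, A, B.comp Δ₂, by simp only [comp_assoc], rfl⟩

/-- The bottom path of a diagram. -/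
def botPath {u v : List α} (Δ : P.Diagram u v) : EdgePath α :=
  Δ.run PathCell.labels_bot (initPath u) (labels_initPath u)

/-- The bottom path of the reduced form of a diagram. -/
noncomputable def reducedBotPath {u v : List α} (Δ : P.Diagram u v) : EdgePath α :=
  Δ.run PathCell.labels_toggle (initPath u) (labels_initPath u)

theorem isBotPath_botPath {v : List α} (Δ : P.Diagram w v) : P.IsBotPath w Δ.botPath := by
  obtain ⟨l, h, rfl⟩ := Δ.exists_eq_ofDerivation
  exact isBotPath_run h

theorem cells_botPath_subset {u v x : List α} {Δ : P.Diagram u v} {Δ' : P.Diagram u x}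
    (h : Δ.IsPrefix Δ') : cells Δ.botPath ⊆ cells Δ'.botPath := by
  obtain ⟨Γ, rfl⟩ := h
  obtain ⟨l, hl, rfl⟩ := Γ.exists_eq_ofDerivation
  rw [botPath, botPath, run_comp]
  exact cells_subset_cells_run hl (labels_run _ _ _)

theorem eq_of_botPath_eq {u v : List α} {Δ Δ' : P.Diagram u v} (h : Δ.botPath = Δ'.botPath) :
    Δ = Δ' := by
  obtain ⟨l, hl, rfl⟩ := Δ.exists_eq_ofDerivation
  obtain ⟨l', hl', rfl⟩ := Δ'.exists_eq_ofDerivation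
  exact ofDerivation_eq_iff.2 (isotopic_of_run_eq hl hl' h)

theorem isDipoleFree_reducedBotPath {u v : List α} (Δ : P.Diagram u v) :
    IsDipoleFree Δ.reducedBotPath := by
  obtain ⟨l, h, rfl⟩ := Δ.exists_eq_ofDerivation
  exact isDipoleFree_run_toggle h (labels_initPath u) (by simp [IsDipoleFree])

theorem ReducesDipole.reducedBotPath_eq {u v : List α} {Δ Δ' : P.Diagram u v}
    (h : Δ.ReducesDipole Δ') : Δ.reducedBotPath = Δ'.reducedBotPath := by
  obtain ⟨c, x, y, _, A, l, hc, -, hA, hΔ', hΔ⟩ :=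
    h.exists_run_eq PathCell.labels_toggle (labels_initPath u)
  have hfree : IsDipoleFree (x ++ c.top ++ y) := hA ▸ isDipoleFree_reducedBotPath A
  rw [reducedBotPath, reducedBotPath, hΔ, hΔ', toggle_toggle hc (hfree.mono _)]
  simp only [cells_append, Set.subset_union_of_subset_left Set.subset_union_right]

theorem not_isReduced_of_gluesLast {l : List (Step α)} {v : List α} {d : PathCell α}
    {x y : EdgePath α} (hd : P.GluesLast w l d x y)
    (h : P.IsDerivation w (l ++ [d.inv.step x y]) v) : ¬ (ofDerivation h).IsReduced := by
  obtain ⟨hdP, l₀, hl₀, -, hiso⟩ := hd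
  obtain ⟨-, -, -, -, rfl⟩ := h.of_append
  rw [labels_append, labels_append] at hl₀
  refine fun hred => hred (ofDerivation hl₀) ⟨labels x, labels d.top, d.botLabel, labels y, hdP,
    ofDerivation hl₀, trivial P _, ofDerivation_eq_iff.2 ?_, (comp_trivial _).symm⟩
  simpa [PathCell.step, PathCell.inv] using hiso.append_right [d.inv.step x y]

theorem IsReduced.reducedBotPath_eq {u v : List α} {Δ : P.Diagram u v} (h : Δ.IsReduced) :
    Δ.reducedBotPath = Δ.botPath := by
  obtain ⟨l, hl, rfl⟩ := Δ.exists_eq_ofDerivation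
  change SemigroupPresentation.run _ (initPath u) l = SemigroupPresentation.run _ (initPath u) l
  induction l using List.reverseRecOn generalizing v with
  | nil => rfl
  | append_singleton l s ih =>
    obtain ⟨m, hl₀, hs⟩ := hl.of_append
    have hrun := ih hl₀ (IsReduced.of_comp (Δ₂ := ofDerivation hs) h)
    obtain ⟨c, x, y, hc, rfl, hxy, hrun', -⟩ :=
      hl.exists_last_step PathCell.labels_bot (labels_initPath u)
    rw [hrun', run_append, hrun, hxy, run_cons, run_nil, act_step]
    rcases c.toggle_cases with ⟨d, rfl, -⟩ | ⟨-, htoggle⟩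
    · exact absurd h (not_isReduced_of_gluesLast (gluesLast_of_run_eq hl₀ hc.top_ne_nil hxy) hl)
    · rw [htoggle]

theorem isReduced_iff {u v : List α} {Δ : P.Diagram u v} :
    Δ.IsReduced ↔ IsDipoleFree Δ.botPath := by
  refine ⟨fun h => h.reducedBotPath_eq ▸ isDipoleFree_reducedBotPath Δ, fun h Δ' hΔ' => ?_⟩
  obtain ⟨c, x, y, -, -, l, hc, hl, -, -, hΔ⟩ :=
    hΔ'.exists_run_eq PathCell.labels_bot (labels_initPath u)
  have hinv : c.inv.bot ≠ [] := PathCell.bot_ne_nil.2 (mt labels_eq_nil.1 hc.top_ne_nil)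
  have hc_mem : c.inv ∈ cells (x ++ c.inv.bot ++ y) := by simp [cells_bot hinv]
  refine h c ?_
  rw [botPath, hΔ]
  exact cells_subset_cells_run hl (by simp) hc_mem

theorem IsReducedForm.reducedBotPath_eq {u v : List α} {Δ R : P.Diagram u v}
    (h : Δ.IsReducedForm R) : Δ.reducedBotPath = R.botPath := by
  obtain ⟨hR, hsteps⟩ := h
  rw [← hR.reducedBotPath_eq]
  clear hR
  induction hsteps with
  | refl => rfl
  | tail _ hstep ih => exact ih.trans hstep.reducedBotPath_eq

end Diagram

/-! ### Vertices and edges of the Farley complex -/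

namespace FarleyVertex

/-- The bottom path of a vertex of `X(P, w)`. -/
def path (D : P.FarleyVertex w) : EdgePath α := D.diagram.botPath

@[simp] theorem path_base : (base P w).path = initPath w := rfl

theorem labels_path (D : P.FarleyVertex w) : labels D.path = D.bot :=
  Diagram.labels_run PathCell.labels_bot (labels_initPath w) D.diagram

theorem isBotPath_path (D : P.FarleyVertex w) : P.IsBotPath w D.path := D.diagram.isBotPath_botPath

theorem isSimple_path (D : P.FarleyVertex w) : IsSimple D.path := D.isBotPath_path.isSimple

theorem isDipoleFree_path (D : P.FarleyVertex w) : IsDipoleFree D.path :=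
  Diagram.isReduced_iff.1 D.isReduced

theorem path_injective : Function.Injective (path (P := P) (w := w)) := by
  intro D E h
  have hbot : D.bot = E.bot := by rw [← labels_path, h, labels_path]
  obtain ⟨u, D, hD⟩ := D
  obtain ⟨v, E, hE⟩ := E
  obtain rfl : u = v := hbot
  obtain rfl := Diagram.eq_of_botPath_eq h
  rfl

theorem exists_path_eq {S : EdgePath α} (hS : P.IsBotPath w S) (hfree : IsDipoleFree S) :
    ∃ D : P.FarleyVertex w, D.path = S := by
  obtain ⟨l, hl, rfl⟩ := hS.exists_derivation
  exact ⟨⟨_, Diagram.ofDerivation hl, Diagram.isReduced_iff.2 hfree⟩, rfl⟩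

theorem eq_of_cells_path_eq {D E : P.FarleyVertex w} (h : cells D.path = cells E.path) : D = E :=
  path_injective (D.isBotPath_path.eq_of_cells_eq E.isBotPath_path h)

theorem botPath_comp (D : P.FarleyVertex w) {x : List α} (Γ : P.Diagram D.bot x) :
    (D.diagram.comp Γ).botPath = Γ.run PathCell.labels_bot D.path D.labels_path :=
  Diagram.run_comp PathCell.labels_bot (labels_initPath w) D.diagram Γ

theorem reducedBotPath_comp (D : P.FarleyVertex w) {x : List α} (Γ : P.Diagram D.bot x) :
    (D.diagram.comp Γ).reducedBotPath = Γ.run PathCell.labels_toggle D.path D.labels_path := by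
  refine (Diagram.run_comp PathCell.labels_toggle (labels_initPath w) D.diagram Γ).trans ?_
  congr 1
  exact D.isReduced.reducedBotPath_eq

theorem IsProduct.path_eq {D E : P.FarleyVertex w} {x : List α} {Γ : P.Diagram D.bot x}
    (h : D.IsProduct Γ E) : E.path = (D.diagram.comp Γ).reducedBotPath := by
  obtain ⟨R, hR, rfl⟩ := h
  exact hR.reducedBotPath_eq.symm

theorem comp_eq_of_run_eq {D E : P.FarleyVertex w} {l : List (Step α)}
    (hl : P.IsDerivation D.bot l E.bot) (h : run PathCell.bot D.path l = E.path) :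
    D.diagram.comp (Diagram.ofDerivation hl) = E.diagram :=
  Diagram.eq_of_botPath_eq ((D.botPath_comp _).trans h)

theorem isProduct_of_run_eq {D E : P.FarleyVertex w} {l : List (Step α)} {x : List α}
    (hl : P.IsDerivation D.bot l x) (h : run PathCell.bot D.path l = E.path) :
    D.IsProduct (Diagram.ofDerivation hl) E := by
  obtain rfl : x = E.bot := by
    rw [← E.labels_path, ← h, labels_run PathCell.labels_bot hl D.labels_path]
  exact ⟨E.diagram, ⟨E.isReduced, comp_eq_of_run_eq hl h ▸ .refl⟩, rfl⟩

end FarleyVertex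

theorem Diagram.exists_isReducedForm {u v : List α} (Δ : P.Diagram u v) :
    ∃ R, Δ.IsReducedForm R := by
  induction hn : Δ.numCells using Nat.strong_induction_on generalizing Δ with | _ n ih =>
  by_cases hred : Δ.IsReduced
  · exact ⟨Δ, hred, .refl⟩
  obtain ⟨Δ', hΔ'⟩ : ∃ Δ', Δ.ReducesDipole Δ' := by simpa [IsReduced] using hred
  have hlt : Δ'.numCells < n := by
    obtain ⟨p, a, b, q, hc, A, B, rfl, rfl⟩ := hΔ'
    have hcell : (cell p q hc).numCells = 1 := rfl
    simp only [numCells_comp] at hn ⊢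
    omega
  obtain ⟨R, hR, hsteps⟩ := ih _ hlt Δ' rfl
  exact ⟨R, hR, .head hΔ' hsteps⟩

theorem FarleyVertex.exists_isProduct (D : P.FarleyVertex w) {x : List α}
    (Γ : P.Diagram D.bot x) : ∃ E, D.IsProduct Γ E := by
  obtain ⟨R, hR⟩ := (D.diagram.comp Γ).exists_isReducedForm
  exact ⟨⟨x, R, hR.1⟩, R, hR, rfl⟩

theorem Glues.exists_isDerivation {c : PathCell α} {S S' : EdgePath α} (h : P.Glues c S S') :
    ∃ s, P.IsDerivation (labels S) [s] (labels S') ∧ run PathCell.bot S [s] = S' := by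
  obtain ⟨hc, x, y, rfl, rfl⟩ := h
  exact ⟨_, hc.isDerivation_step x y, act_step x y c⟩

theorem PathCell.IsOver.toggle_cases {c : PathCell α} (hc : c.IsOver P) :
    c.toggle = c.bot ∨ ∃ d : PathCell α, d.IsOver P ∧ c.top = d.bot ∧ c.toggle = d.top := by
  rcases c.toggle_cases with ⟨d, rfl, htoggle⟩ | ⟨-, htoggle⟩
  · refine .inr ⟨d, ?_, rfl, htoggle⟩
    simpa only [inv, IsOver, labels_bot] using IsCell.symm hc
  · exact .inl htoggle

theorem Diagram.IsAtomic.exists_eq_ofDerivation {u v : List α} {Δ : P.Diagram u v}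
    (hΔ : Δ.IsAtomic) : ∃ (s : Step α) (h : P.IsDerivation u [s] v), Δ = ofDerivation h := by
  obtain ⟨l, h, rfl⟩ := Diagram.exists_eq_ofDerivation Δ
  obtain ⟨s, rfl⟩ := List.length_eq_one_iff.1 hΔ
  exact ⟨s, h, rfl⟩

namespace FarleyVertex

variable {c : PathCell α} {D E : P.FarleyVertex w}

theorem exists_comp_eq_of_glues (h : P.Glues c D.path E.path) :
    ∃ A : P.Diagram D.bot E.bot, A.IsAtomic ∧ E.diagram = D.diagram.comp A := by
  obtain ⟨s, hs, hrun⟩ := h.exists_isDerivation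
  rw [labels_path, labels_path] at hs
  exact ⟨Diagram.ofDerivation hs, rfl, (comp_eq_of_run_eq hs hrun).symm⟩

theorem adj_of_glues (h : P.Glues c D.path E.path) : (farleyGraph P w).Adj D E := by
  have hne : D ≠ E := by
    rintro rfl
    exact h.notMem_cells D.isSimple_path h.isExposed.mem_cells
  obtain ⟨s, hs, hrun⟩ := h.exists_isDerivation
  rw [labels_path] at hs
  exact (SimpleGraph.fromRel_adj _ _ _).2
    ⟨hne, .inl ⟨_, Diagram.ofDerivation hs, rfl, isProduct_of_run_eq hs hrun⟩⟩

theorem glues_or_glues_of_isProduct {x : List α} {A : P.Diagram D.bot x} (hA : A.IsAtomic)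
    (h : D.IsProduct A E) : ∃ c, P.Glues c D.path E.path ∨ P.Glues c E.path D.path := by
  obtain ⟨s, hs, rfl⟩ := hA.exists_eq_ofDerivation
  obtain ⟨c, x, y, hD, rfl⟩ := exists_eq_step (D.labels_path.trans hs.2.1.symm)
  have hE : E.path = x ++ c.toggle ++ y := by
    rw [h.path_eq, reducedBotPath_comp, ← act_step, ← hD]
    rfl
  rcases PathCell.IsOver.toggle_cases hs.1 with htoggle | ⟨d, hd, htop, htoggle⟩
  · exact ⟨c, .inl ⟨hs.1, x, y, hD, htoggle ▸ hE⟩⟩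
  · exact ⟨d, .inr ⟨hd, x, y, htoggle ▸ hE, htop ▸ hD⟩⟩

theorem adj_iff : (farleyGraph P w).Adj D E ↔
    ∃ c, P.Glues c D.path E.path ∨ P.Glues c E.path D.path := by
  refine ⟨fun h => ?_, fun ⟨c, h⟩ => h.elim adj_of_glues fun h => (adj_of_glues h).symm⟩
  rcases ((SimpleGraph.fromRel_adj _ _ _).1 h).2 with ⟨x, A, hA, h⟩ | ⟨x, A, hA, h⟩
  · exact glues_or_glues_of_isProduct hA h
  · exact (glues_or_glues_of_isProduct hA h).imp fun _ => Or.symm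

theorem exists_path_eq_of_glues {S : EdgePath α} (hS : P.IsBotPath w S)
    (h : P.Glues c S E.path) : ∃ D : P.FarleyVertex w, D.path = S :=
  exists_path_eq hS (E.isDipoleFree_path.mono (h.cells_eq ▸ Set.subset_insert _ _))

theorem exists_glues_of_isExposed (hc : c.IsExposed E.path) :
    ∃ D : P.FarleyVertex w, P.Glues c D.path E.path := by
  obtain ⟨S, hS, hglues⟩ := hc.exists_glues E.isBotPath_path
  obtain ⟨D, rfl⟩ := exists_path_eq_of_glues hS hglues
  exact ⟨D, hglues⟩

theorem glues_induction {p : P.FarleyVertex w → Prop}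
    (h : ∀ E, (∀ D c, P.Glues c D.path E.path → p D) → p E) (E : P.FarleyVertex w) : p E := by
  induction hn : E.diagram.numCells using Nat.strong_induction_on generalizing E with | _ n ih =>
  refine h E fun D c hglues => ih _ ?_ D rfl
  obtain ⟨A, hA, hE⟩ := exists_comp_eq_of_glues hglues
  rw [← hn, hE, Diagram.numCells_comp, hA]
  exact Nat.lt_succ_self _

end FarleyVertex

/-! ### Thin and minimal diagrams -/

section Thin

variable {f : PathCell α → EdgePath α}

theorem run_whisker (hf : ∀ c, labels (f c) = c.botLabel) (x y : EdgePath α) {S : EdgePath α}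
    {l : List (Step α)} {u v : List α} (hl : P.IsDerivation u l v) (hS : labels S = u) :
    run f (x ++ S ++ y) (l.map (Step.whisker (labels x) (labels y))) = x ++ run f S l ++ y := by
  induction l generalizing S u with
  | nil => rfl
  | cons s l ih =>
    obtain ⟨c, a, b, rfl, rfl⟩ := exists_eq_step (hS.trans hl.2.1.symm)
    have hstep : (c.step a b).whisker (labels x) (labels y) = c.step (x ++ a) (b ++ y) := by
      simp [PathCell.step, Step.whisker]
    have hact : act f (x ++ (a ++ c.top ++ b) ++ y) (c.step (x ++ a) (b ++ y)) =
        x ++ (a ++ f c ++ b) ++ y := by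
      simpa only [List.append_assoc] using act_step (f := f) (x ++ a) (b ++ y) c
    rw [List.map_cons, run_cons, run_cons, hstep, hact, act_step]
    exact ih hl.2.2 (by simp [hf, PathCell.step, Step.bot])

namespace Diagram

theorem run_sum (hf : ∀ c, labels (f c) = c.botLabel) {S T : EdgePath α} {u v u' v' : List α}
    (hS : labels S = u) (hT : labels T = u') (hST : labels (S ++ T) = u ++ u')
    (Δ : P.Diagram u v) (Δ' : P.Diagram u' v') :
    (Δ.sum Δ').run hf (S ++ T) hST = Δ.run hf S hS ++ Δ'.run hf T hT := by
  obtain ⟨l, h, rfl⟩ := Δ.exists_eq_ofDerivation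
  obtain ⟨l', h', rfl⟩ := Δ'.exists_eq_ofDerivation
  have hleft := run_whisker hf [] T h hS
  have hright := run_whisker hf (SemigroupPresentation.run f S l) [] h' hT
  rw [SemigroupPresentation.labels_run hf h hS] at hright
  subst hT
  simp only [List.nil_append, List.append_nil] at hleft hright
  rw [← hleft] at hright
  exact (run_append _ _ _).trans hright

theorem numCells_sum {u v u' v' : List α} (Δ : P.Diagram u v) (Δ' : P.Diagram u' v') :
    (Δ.sum Δ').numCells = Δ.numCells + Δ'.numCells := by
  obtain ⟨l, h, rfl⟩ := Δ.exists_eq_ofDerivation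
  obtain ⟨l', h', rfl⟩ := Δ'.exists_eq_ofDerivation
  refine List.length_append.trans ?_
  simp [numCells_ofDerivation]

theorem run_of_numCells_eq_zero (hf : ∀ c, labels (f c) = c.botLabel) {S : EdgePath α}
    {u v : List α} (hS : labels S = u) {Δ : P.Diagram u v} (h : Δ.numCells = 0) :
    Δ.run hf S hS = S := by
  obtain ⟨l, hl, rfl⟩ := Δ.exists_eq_ofDerivation
  obtain rfl := List.length_eq_zero_iff.1 h
  rfl

theorem isSuffix_of_numCells_eq_zero {u v x : List α} {Δ : P.Diagram u x} {F : P.Diagram v x}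
    (h : F.numCells = 0) : F.IsSuffix Δ := by
  obtain ⟨l, hl, rfl⟩ := F.exists_eq_ofDerivation
  obtain rfl := List.length_eq_zero_iff.1 h
  obtain rfl : v = x := hl
  exact ⟨Δ, (comp_trivial Δ).symm⟩

theorem IsThin.exists_run_eq {u v : List α} {Γ : P.Diagram u v} (hΓ : Γ.IsThin)
    (hn : 0 < Γ.numCells) {S : EdgePath α} (hS : labels S = u) :
    ∃ (c : PathCell α) (x y T : EdgePath α) (v' : List α) (Γ' : P.Diagram (labels T) v'),
      c.IsOver P ∧ Γ'.IsThin ∧ Γ.numCells = Γ'.numCells + 1 ∧ S = x ++ c.top ++ y ++ T ∧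
        Γ.run PathCell.labels_bot S hS =
          x ++ c.bot ++ y ++ Γ'.run PathCell.labels_bot T rfl := by
  cases hΓ with
  | trivial => exact absurd hn (lt_irrefl 0)
  | sum A Γ' hA hΓ' =>
    obtain ⟨S', T, rfl, hS', rfl⟩ := exists_eq_append_of_labels_eq hS
    obtain ⟨s, hs, rfl⟩ := hA.exists_eq_ofDerivation
    obtain ⟨c, x, y, rfl, rfl⟩ := exists_eq_step (hS'.trans hs.2.1.symm)
    refine ⟨c, x, y, T, _, Γ', hs.1, hΓ', ?_, rfl, ?_⟩
    · rw [numCells_sum, hA, add_comm]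
    · rw [run_sum PathCell.labels_bot hS' rfl]
      exact congrArg (· ++ _) (act_step x y c)

theorem IsThin.exists_run_eq_of_two_le {u v : List α} {Γ : P.Diagram u v} (hΓ : Γ.IsThin)
    (hn : 2 ≤ Γ.numCells) {S : EdgePath α} (hS : labels S = u) :
    ∃ (c d : PathCell α) (x z y : EdgePath α), c.IsOver P ∧ d.IsOver P ∧
      Γ.run PathCell.labels_bot S hS = x ++ c.bot ++ z ++ d.bot ++ y ∧
      (Γ.numCells = 2 → S = x ++ c.top ++ z ++ d.top ++ y) := by
  obtain ⟨c, x, z, T, _, Γ', hc, hΓ', hcells, rfl, hrun⟩ := hΓ.exists_run_eq (by omega) hS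
  obtain ⟨d, z', y, T, _, Γ'', hd, -, hcells', rfl, hrun'⟩ := hΓ'.exists_run_eq (by omega) rfl
  refine ⟨c, d, x, z ++ z', y ++ Γ''.run PathCell.labels_bot T rfl, hc, hd, ?_, fun h2 => ?_⟩
  · rw [hrun, hrun']
    simp only [List.append_assoc]
  · simp [run_of_numCells_eq_zero PathCell.labels_bot rfl (by omega : Γ''.numCells = 0)]

theorem IsThin.congr {u v u' v' : List α} {l l' : List (Step α)} {h : P.IsDerivation u l v}
    (hthin : (ofDerivation h).IsThin) {h' : P.IsDerivation u' l' v'} (hu : u = u') (hv : v = v')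
    (hl : l = l') : (ofDerivation h').IsThin := by
  subst hu hv hl
  exact hthin

theorem IsAtomic.isThin {u v : List α} {A : P.Diagram u v} (hA : A.IsAtomic) : A.IsThin := by
  obtain ⟨s, h, rfl⟩ := hA.exists_eq_ofDerivation
  refine (IsThin.sum (ofDerivation h) (trivial P []) rfl (.trivial [])).congr
    (List.append_nil u) (List.append_nil v) ?_
  simp [Step.whisker]

end Diagram

end Thin

theorem eq_of_isotopic_singleton {s s' : Step α} (h : Isotopic [s] [s']) : s = s' := by
  have hinv : ∀ l l' : List (Step α), Exchange l l' →
      (if l.length = 1 then l.head? else none) = if l'.length = 1 then l'.head? else none := by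
    rintro _ _ ⟨l₁, l₂⟩
    rw [if_neg, if_neg] <;> simp [← add_assoc]
  simpa using congrArg (Quot.lift _ hinv) h

namespace Diagram

variable {c : PathCell α} {v : List α} {Δ : P.Diagram w v}

theorem exists_botPath_eq_of_isSuffix {u : List α} {s : Step α} {h : P.IsDerivation u [s] v}
    (hs : (ofDerivation h).IsSuffix Δ) :
    ∃ c x y, PathCell.IsOver P c ∧ s = c.step x y ∧ Δ.botPath = x ++ c.bot ++ y := by
  obtain ⟨G, rfl⟩ := hs
  obtain ⟨l, hl, rfl⟩ := G.exists_eq_ofDerivation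
  obtain ⟨c, x, y, hc, hs, -, hrun, -⟩ :=
    (hl.append h).exists_last_step PathCell.labels_bot (labels_initPath w)
  exact ⟨c, x, y, hc, hs, hrun⟩

theorem exists_isSuffix_of_botPath_eq (hc : c.bot ≠ []) {x y : EdgePath α}
    (h : Δ.botPath = x ++ c.bot ++ y) :
    ∃ hs : P.IsDerivation (labels (x ++ c.top ++ y)) [c.step x y] v,
      (ofDerivation hs).IsSuffix Δ := by
  obtain ⟨l, hl, rfl⟩ := Δ.exists_eq_ofDerivation
  obtain ⟨-, l₀, hl₀, -, hiso⟩ := gluesLast_of_run_eq hl hc h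
  obtain ⟨m, -, hs⟩ := (hiso.isDerivation_iff.1 hl).of_append
  obtain rfl : m = labels (x ++ c.top ++ y) := by
    simpa [PathCell.step, Step.top] using hs.2.1.symm
  exact ⟨hs, ofDerivation hl₀, ofDerivation_eq_iff.2 hiso⟩

theorem numCells_le_one_of_isTip (hc : IsTip c Δ.botPath) {u : List α} {F : P.Diagram u v}
    (hF : F.IsThin) (hsuf : F.IsSuffix Δ) : F.numCells ≤ 1 := by
  by_contra! hn
  obtain ⟨G, rfl⟩ := hsuf
  obtain ⟨d, d', x, z, y, hd, hd', hrun, -⟩ :=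
    hF.exists_run_eq_of_two_le hn (labels_run PathCell.labels_bot (labels_initPath w) G)
  rw [← run_comp] at hrun
  have hnodup := (G.comp F).isBotPath_botPath.isSimple.nodup
  obtain rfl := hc.2 d ⟨hd.bot_ne_nil, x, z ++ d'.bot ++ y, by simp [botPath, hrun]⟩
  obtain rfl := hc.2 d' ⟨hd'.bot_ne_nil, x ++ d.bot ++ z, y, by simp [botPath, hrun]⟩
  obtain ⟨e, he⟩ := List.exists_mem_of_ne_nil _ hd.bot_ne_nil
  rw [botPath, hrun] at hnodup
  exact (List.nodup_append.1 (List.nodup_append.1 hnodup).1).2.2 e (by simp [he]) e he rfl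

theorem isMinimal_of_isTip (hc : IsTip c Δ.botPath) : Δ.IsMinimal := by
  obtain ⟨hne, x, y, hbot⟩ := hc.isExposed Δ.isBotPath_botPath
  obtain ⟨hs, hsuf⟩ := exists_isSuffix_of_botPath_eq hne hbot.symm
  refine ⟨_, ofDerivation hs, ⟨IsAtomic.isThin rfl, hsuf, fun u F hF hFsuf => ?_⟩, rfl⟩
  rcases Nat.le_one_iff_eq_zero_or_eq_one.1 (numCells_le_one_of_isTip hc hF hFsuf) with h0 | h1
  · exact isSuffix_of_numCells_eq_zero h0
  obtain ⟨s, hs', rfl⟩ := IsAtomic.exists_eq_ofDerivation h1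
  obtain ⟨d, x', y', hd, rfl, hbot'⟩ := exists_botPath_eq_of_isSuffix hFsuf
  obtain rfl := hc.2 d ⟨hd.bot_ne_nil, x', y', hbot'.symm⟩
  obtain ⟨rfl, rfl⟩ := append_inj_of_nodup hne (hbot ▸ Δ.isBotPath_botPath.isSimple.nodup)
    (hbot.trans hbot')
  obtain rfl : labels (x ++ d.top ++ y) = u := hs.2.1.symm.trans hs'.2.1
  exact ⟨trivial P _, (trivial_comp _).symm⟩

theorem step_eq_of_isSuffix {u u' v : List α} {s s' : Step α} {h : P.IsDerivation u [s] v}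
    {h' : P.IsDerivation u' [s'] v} (hs : (ofDerivation h').IsSuffix (ofDerivation h)) :
    s' = s := by
  obtain ⟨G, hG⟩ := hs
  obtain ⟨l, hl, rfl⟩ := G.exists_eq_ofDerivation
  have hlen : 1 = l.length + 1 := (congrArg numCells hG).trans (numCells_comp _ _)
  obtain rfl := List.length_eq_zero_iff.1 (Nat.succ_injective hlen).symm
  exact (eq_of_isotopic_singleton (ofDerivation_eq_iff.1 hG)).symm

theorem IsMaximalThinSuffix.isTip {x y : EdgePath α} (hc : c.bot ≠ [])
    {h : P.IsDerivation (labels (x ++ c.top ++ y)) [c.step x y] v}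
    (hF : (ofDerivation h).IsMaximalThinSuffix Δ) (hbot : Δ.botPath = x ++ c.bot ++ y) :
    IsTip c Δ.botPath := by
  refine ⟨PathCell.IsExposed.mem_cells ⟨hc, x, y, hbot.symm⟩, fun d ⟨hd, x', y', hbot'⟩ => ?_⟩
  obtain ⟨hs, hsuf⟩ := exists_isSuffix_of_botPath_eq hd hbot'.symm
  have hstep := step_eq_of_isSuffix (hF.2.2 _ _ (IsAtomic.isThin rfl) hsuf)
  obtain ⟨hx, -, hlabel, -⟩ := Step.mk.injEq .. ▸ hstep
  refine PathCell.eq_of_bot_eq hd ?_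
  rw [hbot, List.append_assoc, List.append_assoc] at hbot'
  have hlen : x'.length = x.length := by rw [← length_labels, hx, length_labels]
  refine (List.append_inj (List.append_inj hbot' hlen).2 ?_).1
  rw [← length_labels, ← length_labels, PathCell.labels_bot, PathCell.labels_bot, hlabel]

end Diagram

theorem FarleyVertex.exists_isTip_of_isMaximalThinSuffix {D : P.FarleyVertex w} {v : List α}
    {F : P.Diagram v D.bot} (hF : F.IsMaximalThinSuffix D.diagram) (h1 : F.numCells = 1) :
    ∃ c, IsTip c D.path ∧
      ∀ E : P.FarleyVertex w, D.IsProduct F.inv E → P.Glues c E.path D.path := by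
  obtain ⟨s, hs, rfl⟩ := Diagram.IsAtomic.exists_eq_ofDerivation h1
  obtain ⟨c, x, y, hc, rfl, hbot⟩ := Diagram.exists_botPath_eq_of_isSuffix hF.2.1
  have hv : labels (x ++ c.top ++ y) = v := by simpa [PathCell.step, Step.top] using hs.2.1
  subst hv
  refine ⟨c, hF.isTip hc.bot_ne_nil hbot, fun E hE => ⟨hc, x, y, ?_, hbot⟩⟩
  have hstep : (c.step x y).inv = c.inv.step x y := by simp [PathCell.step, PathCell.inv, Step.inv]
  calc E.path = act PathCell.toggle D.path (c.step x y).inv :=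
        hE.path_eq.trans (D.reducedBotPath_comp _)
    _ = x ++ c.inv.toggle ++ y := by
        rw [show D.path = _ from hbot, hstep]
        exact act_step x y c.inv
    _ = x ++ c.top ++ y := by rw [PathCell.toggle_inv hc.bot_ne_nil]

/-! ### Squares -/

theorem PathCell.IsOver.exists_cond_toggle_eq {c : PathCell α} (hc : c.IsOver P) :
    ∃ d : PathCell α, d.IsOver P ∧
      ∀ i, ∃ i', cond i c.toggle c.top = cond i' d.bot d.top := by
  rcases hc.toggle_cases with h | ⟨d, hd, htop, htoggle⟩
  · exact ⟨c, hc, fun i => ⟨i, by rw [h]⟩⟩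
  · exact ⟨d, hd, fun i => ⟨!i, by cases i <;> simp [htop, htoggle]⟩⟩

theorem IsBotPath.of_glues {c : PathCell α} {S S' : EdgePath α} (hS' : P.IsBotPath w S')
    (h : P.Glues c S S') : P.IsBotPath w S := by
  obtain ⟨hc, x, y, rfl, rfl⟩ := h
  exact (hS'.of_bot hc.bot_ne_nil).2

/-- Two cells with disjoint top paths: `left` and `right` can be glued independently to the path
`pre ++ left.top ++ mid ++ right.top ++ post`, and thus span a square. -/
structure CellPair (α : Type*) where
  left : PathCell α
  right : PathCell α
  pre : EdgePath α
  mid : EdgePath α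
  post : EdgePath α

namespace CellPair

/-- Both cells of the pair are labelled by relations of `P`. -/
def IsOver (P : SemigroupPresentation α) (q : CellPair α) : Prop :=
  q.left.IsOver P ∧ q.right.IsOver P

/-- The corner `(i, j)` of the square spanned by `q`: the left cell is glued if `i = true`, and the
right one if `j = true`, where gluing `c` means replacing `c.top` by `f c`. -/
def path (q : CellPair α) (f : PathCell α → EdgePath α) (i j : Bool) : EdgePath α :=
  q.pre ++ cond i (f q.left) q.left.top ++ q.mid ++ cond j (f q.right) q.right.top ++ q.post

/-- A derivation from the corner `(false, false)` of the square to the corner `(i, j)`. -/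
def steps (q : CellPair α) : Bool → Bool → List (Step α)
  | false, false => []
  | true, false => [q.left.step q.pre (q.mid ++ q.right.top ++ q.post)]
  | false, true => [q.right.step (q.pre ++ q.left.top ++ q.mid) q.post]
  | true, true => [q.left.step q.pre (q.mid ++ q.right.top ++ q.post),
      q.right.step (q.pre ++ q.left.bot ++ q.mid) q.post]

variable {q : CellPair α}

theorem run_steps {f : PathCell α → EdgePath α} (hf : ∀ c, labels (f c) = c.botLabel)
    (i j : Bool) : run f (q.path f false false) (q.steps i j) = q.path f i j := by
  have hleft := act_step (f := f) q.pre (q.mid ++ q.right.top ++ q.post) q.left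
  simp only [← List.append_assoc] at hleft
  cases i <;> cases j
  · rfl
  · exact act_step _ _ _
  · exact hleft
  · exact act_act_left_right hf _ _ _ _ _

theorem isDerivation_steps (hq : q.IsOver P) (i j : Bool) :
    P.IsDerivation (labels (q.path PathCell.bot false false)) (q.steps i j)
      (labels (q.path PathCell.bot i j)) := by
  have hleft (y : EdgePath α) := hq.1.isDerivation_step q.pre (q.mid ++ y ++ q.post)
  have hright (x : EdgePath α) := hq.2.isDerivation_step (q.pre ++ x ++ q.mid) q.post
  simp only [← List.append_assoc] at hleft
  cases i <;> cases j
  · rfl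
  · exact hright _
  · exact hleft _
  · exact (hleft _).append (hright _)

theorem exists_isotopic_steps_append (q : CellPair α) (i j : Bool) :
    ∃ l, Isotopic (q.steps true true) (q.steps i j ++ l) := by
  cases i <;> cases j
  · exact ⟨_, rfl⟩
  · exact ⟨[_], isotopic_step_swap _ _ _ _ _⟩
  · exact ⟨[_], rfl⟩
  · exact ⟨[], by rw [List.append_nil]; rfl⟩

theorem isThin_steps (hq : q.IsOver P) :
    (Diagram.ofDerivation (isDerivation_steps hq true true)).IsThin := by
  have hleft := hq.1.isDerivation_step q.pre []
  have hright := hq.2.isDerivation_step q.mid q.post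
  exact (Diagram.IsThin.sum (Diagram.ofDerivation hleft) (Diagram.ofDerivation hright) rfl
    (Diagram.IsAtomic.isThin rfl)).congr (by simp [path]) (by simp [path])
    (by simp [steps, PathCell.step, Step.whisker, labels])

-- Toggling a cell that closes a dipole removes its partner, so `q'` contains the partners of such
-- cells.
theorem exists_path_toggle_eq (hq : q.IsOver P) :
    ∃ q' : CellPair α, q'.IsOver P ∧
      ∀ i j, ∃ i' j', q.path PathCell.toggle i j = q'.path PathCell.bot i' j' := by
  obtain ⟨c, hc, hleft⟩ := hq.1.exists_cond_toggle_eq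
  obtain ⟨d, hd, hright⟩ := hq.2.exists_cond_toggle_eq
  refine ⟨⟨c, d, q.pre, q.mid, q.post⟩, ⟨hc, hd⟩, fun i j => ?_⟩
  obtain ⟨i', hi'⟩ := hleft i
  obtain ⟨j', hj'⟩ := hright j
  exact ⟨i', j', by rw [path, path, hi', hj']⟩

theorem glues_left (hq : q.IsOver P) (j : Bool) :
    P.Glues q.left (q.path PathCell.bot false j) (q.path PathCell.bot true j) :=
  ⟨hq.1, q.pre, q.mid ++ cond j q.right.bot q.right.top ++ q.post, by simp [path], by simp [path]⟩

theorem glues_right (hq : q.IsOver P) (i : Bool) :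
    P.Glues q.right (q.path PathCell.bot i false) (q.path PathCell.bot i true) :=
  ⟨hq.2, q.pre ++ cond i q.left.bot q.left.top ++ q.mid, q.post, rfl, rfl⟩

theorem isBotPath_path_false_false (hq : q.IsOver P) {i j : Bool}
    (h : P.IsBotPath w (q.path PathCell.bot i j)) :
    P.IsBotPath w (q.path PathCell.bot false false) := by
  have hj : P.IsBotPath w (q.path PathCell.bot i false) :=
    match j with
    | false => h
    | true => h.of_glues (glues_right hq i)
  exact match i with
    | false => hj
    | true => hj.of_glues (glues_left hq false)

theorem isBotPath_path (hq : q.IsOver P)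
    (h : P.IsBotPath w (q.path PathCell.bot false false)) (i j : Bool) :
    P.IsBotPath w (q.path PathCell.bot i j) :=
  have hi : P.IsBotPath w (q.path PathCell.bot i false) :=
    match i with
    | false => h
    | true => h.glue (glues_left hq false)
  match j with
  | false => hi
  | true => hi.glue (glues_right hq i)

theorem mem_cells_path (hq : q.IsOver P) {i j : Bool} {c : PathCell α} :
    c ∈ cells (q.path PathCell.bot i j) ↔ c ∈ cells (q.path PathCell.bot false false) ∨
      (i = true ∧ c = q.left) ∨ (j = true ∧ c = q.right) := by
  have hleft := (glues_left hq false).cells_eq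
  have hright (i : Bool) := (glues_right hq i).cells_eq
  cases i <;> cases j <;> simp [hleft, hright] <;> tauto

theorem left_ne_right (hq : q.IsOver P) (hsimple : IsSimple (q.path PathCell.bot false false)) :
    q.left ≠ q.right := fun h =>
  (glues_right hq true).notMem_cells ((glues_left hq false).isSimple hsimple)
    ((mem_cells_path hq).2 (.inr (.inl ⟨rfl, h.symm⟩)))

theorem left_mem_cells_path (hq : q.IsOver P)
    (hsimple : IsSimple (q.path PathCell.bot false false)) {i j : Bool} :
    q.left ∈ cells (q.path PathCell.bot i j) ↔ i = true := by
  simp [mem_cells_path hq (i := i), (glues_left hq false).notMem_cells hsimple,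
    left_ne_right hq hsimple]

theorem right_mem_cells_path (hq : q.IsOver P)
    (hsimple : IsSimple (q.path PathCell.bot false false)) {i j : Bool} :
    q.right ∈ cells (q.path PathCell.bot i j) ↔ j = true := by
  simp [mem_cells_path hq (i := i), (glues_right hq false).notMem_cells hsimple,
    (left_ne_right hq hsimple).symm]

theorem exists_eq_path (hq : q.IsOver P) {S : EdgePath α} (hS : P.IsBotPath w S)
    (hcorner : P.IsBotPath w (q.path PathCell.bot true true))
    (hsub : cells (q.path PathCell.bot false false) ⊆ cells S)
    (hsub' : cells S ⊆ cells (q.path PathCell.bot true true)) :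
    ∃ i j, S = q.path PathCell.bot i j := by
  classical
  have h₀ := isBotPath_path_false_false hq hcorner
  refine ⟨decide (q.left ∈ cells S), decide (q.right ∈ cells S), hS.eq_of_cells_eq
    (isBotPath_path hq h₀ _ _) (Set.ext fun c => ?_)⟩
  rw [mem_cells_path hq, decide_eq_true_iff, decide_eq_true_iff]
  have hc := mt (@hsub' c)
  rw [mem_cells_path hq] at hc
  grind

theorem eq_of_glues_path (hq : q.IsOver P) {c : PathCell α} {i j i' j' : Bool}
    (hS : P.IsBotPath w (q.path PathCell.bot i j))
    (h : P.Glues c (q.path PathCell.bot i j) (q.path PathCell.bot i' j')) :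
    (c = q.left ∧ i = false ∧ i' = true ∧ j = j') ∨
      (c = q.right ∧ j = false ∧ j' = true ∧ i = i') := by
  have hsimple := (isBotPath_path_false_false hq hS).isSimple
  have hne := left_ne_right hq hsimple
  have hnotMem := h.notMem_cells hS.isSimple
  have hmem : c ∈ cells (q.path PathCell.bot i' j') := h.isExposed.mem_cells
  have hleft := left_mem_cells_path hq hsimple (i := i') (j := j')
  have hright := right_mem_cells_path hq hsimple (i := i') (j := j')
  rw [h.cells_eq, Set.mem_insert_iff, left_mem_cells_path hq hsimple] at hleft
  rw [h.cells_eq, Set.mem_insert_iff, right_mem_cells_path hq hsimple] at hright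
  rw [mem_cells_path hq] at hnotMem hmem
  grind

end CellPair

namespace FarleyVertex

theorem IsProduct.path_eq_path {D E : P.FarleyVertex w} {q : CellPair α} (hq : q.IsOver P)
    (hD : D.path = q.path PathCell.bot false false) {x : List α} {Q : P.Diagram D.bot x}
    {i j : Bool} (hQ : (D.diagram.comp Q).botPath = q.path PathCell.bot i j)
    (hE : D.IsProduct Q E) : E.path = q.path PathCell.toggle i j := by
  have hsteps := q.isDerivation_steps hq i j
  rw [← hD, D.labels_path] at hsteps
  obtain rfl : labels (q.path PathCell.bot i j) = x := by
    rw [← hQ, D.botPath_comp, Diagram.labels_run]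
  have hcomp : D.diagram.comp Q = D.diagram.comp (Diagram.ofDerivation hsteps) := by
    refine Diagram.eq_of_botPath_eq (hQ.trans ?_)
    rw [D.botPath_comp]
    exact (hD ▸ CellPair.run_steps PathCell.labels_bot i j).symm
  rw [hE.path_eq, hcomp, D.reducedBotPath_comp]
  exact (congrArg (run PathCell.toggle · (q.steps i j)) hD).trans
    (CellPair.run_steps PathCell.labels_toggle i j)

theorem exists_botPath_comp_eq_path {D : P.FarleyVertex w} {q : CellPair α} (hq : q.IsOver P)
    (hD : D.path = q.path PathCell.bot false false) {x y : List α} {Q : P.Diagram D.bot x}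
    {Γ : P.Diagram D.bot y} (hΓ : (D.diagram.comp Γ).botPath = q.path PathCell.bot true true)
    (hQ : Q.IsPrefix Γ) : ∃ i j, (D.diagram.comp Q).botPath = q.path PathCell.bot i j := by
  obtain ⟨Q', rfl⟩ := hQ
  refine CellPair.exists_eq_path hq (Diagram.isBotPath_botPath _)
    (hΓ ▸ Diagram.isBotPath_botPath _) ?_ ?_
  · rw [← hD]
    exact Diagram.cells_botPath_subset ⟨Q, rfl⟩
  · rw [← hΓ, ← Diagram.comp_assoc]
    exact Diagram.cells_botPath_subset ⟨Q', rfl⟩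

end FarleyVertex

theorem IsCube.exists_cellPair {S : Set (P.FarleyVertex w)} (hS : IsCube 2 S) :
    ∃ q : CellPair α, q.IsOver P ∧ ∀ E ∈ S, ∃ i j, E.path = q.path PathCell.bot i j := by
  obtain ⟨D, y, Γ, hΓ, hn, rfl⟩ := hS
  obtain ⟨c, d, x, z, y, hc, hd, hrun, hD⟩ := hΓ.exists_run_eq_of_two_le hn.ge D.labels_path
  obtain ⟨q', hq', hpath⟩ :=
    CellPair.exists_path_toggle_eq (P := P) (q := ⟨c, d, x, z, y⟩) ⟨hc, hd⟩
  refine ⟨q', hq', ?_⟩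
  rintro E ⟨v, Q, hQ, hE⟩
  obtain ⟨i, j, hij⟩ := FarleyVertex.exists_botPath_comp_eq_path (q := ⟨c, d, x, z, y⟩) ⟨hc, hd⟩
    (hD hn) ((D.botPath_comp Γ).trans hrun) hQ
  rw [hE.path_eq_path (q := ⟨c, d, x, z, y⟩) ⟨hc, hd⟩ (hD hn) hij]
  exact hpath i j

/-- The edge `e` of `X(P, w)` joins a diagram to the diagram obtained by gluing `c` to it. -/
def EdgeGlues (e : Sym2 (P.FarleyVertex w)) (c : PathCell α) : Prop :=
  ∃ D E, e = s(D, E) ∧ P.Glues c D.path E.path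

theorem exists_edgeGlues {e : Sym2 (P.FarleyVertex w)} (he : e ∈ (farleyGraph P w).edgeSet) :
    ∃ c, EdgeGlues e c := by
  induction e with | _ D E =>
  obtain ⟨c, h | h⟩ := FarleyVertex.adj_iff.1 he
  · exact ⟨c, D, E, rfl, h⟩
  · exact ⟨c, E, D, Sym2.eq_swap, h⟩

theorem EdgeGlues.unique {e : Sym2 (P.FarleyVertex w)} {c d : PathCell α} (hc : EdgeGlues e c)
    (hd : EdgeGlues e d) : c = d := by
  obtain ⟨D, E, rfl, hc⟩ := hc
  obtain ⟨D', E', h, hd⟩ := hd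
  have hc_notMem := hc.notMem_cells D.isSimple_path
  have hd_notMem := hd.notMem_cells D'.isSimple_path
  have hc_mem := hc.isExposed.mem_cells
  have hd_mem := hd.isExposed.mem_cells
  rcases Sym2.eq_iff.1 h with ⟨rfl, rfl⟩ | ⟨rfl, rfl⟩
  · rw [hd.cells_eq] at hc_mem
    exact hc_mem.resolve_right hc_notMem
  · rw [hc.cells_eq] at hd_notMem
    exact absurd (Set.mem_insert_of_mem _ hd_mem) hd_notMem

-- If the two edges glued different cells of the square, they would share a corner.
theorem AreParallelSides.eq_of_edgeGlues {e f : (farleyGraph P w).edgeSet}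
    (h : AreParallelSides e f) {c d : PathCell α} (hc : EdgeGlues e.1 c) (hd : EdgeGlues f.1 d) :
    c = d := by
  obtain ⟨S, hS, he, hf, hef⟩ := h
  obtain ⟨q, hq, hpath⟩ := hS.exists_cellPair
  obtain ⟨D, E, he_eq, hc⟩ := hc
  obtain ⟨D', E', hf_eq, hd⟩ := hd
  simp only [he_eq, hf_eq, Sym2.mem_iff, forall_eq_or_imp, forall_eq, not_or] at he hf hef
  obtain ⟨i, j, hD⟩ := hpath D he.1
  obtain ⟨i', j', hE⟩ := hpath E he.2
  obtain ⟨k, l, hD'⟩ := hpath D' hf.1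
  obtain ⟨k', l', hE'⟩ := hpath E' hf.2
  simp only [← FarleyVertex.path_injective.eq_iff, hD, hE, hD', hE'] at hc hd hef
  rcases CellPair.eq_of_glues_path hq (hD ▸ D.isBotPath_path) hc with
    ⟨rfl, rfl, rfl, rfl⟩ | ⟨rfl, rfl, rfl, rfl⟩ <;>
  rcases CellPair.eq_of_glues_path hq (hD' ▸ D'.isBotPath_path) hd with
    ⟨rfl, rfl, rfl, rfl⟩ | ⟨rfl, rfl, rfl, rfl⟩
  · rfl
  · cases j <;> cases k <;> simp at hef
  · cases i <;> cases l <;> simp at hef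
  · rfl

namespace CellPair

variable {q : CellPair α} {V : Bool → Bool → P.FarleyVertex w}

theorem exists_vertices (hq : q.IsOver P) {E : P.FarleyVertex w}
    (hE : E.path = q.path PathCell.bot true true) :
    ∃ V : Bool → Bool → P.FarleyVertex w, ∀ i j, (V i j).path = q.path PathCell.bot i j := by
  have hbot := isBotPath_path hq (isBotPath_path_false_false hq (hE ▸ E.isBotPath_path))
  obtain ⟨D₁, hD₁⟩ := FarleyVertex.exists_path_eq_of_glues (hbot true false)
    (hE ▸ glues_right hq true)
  have hvertex (i j : Bool) : ∃ D : P.FarleyVertex w, D.path = q.path PathCell.bot i j := by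
    cases i <;> cases j
    · exact FarleyVertex.exists_path_eq_of_glues (hbot _ _) (hD₁ ▸ glues_left hq false)
    · exact FarleyVertex.exists_path_eq_of_glues (hbot _ _) (hE ▸ glues_left hq true)
    · exact ⟨D₁, hD₁⟩
    · exact ⟨E, hE⟩
  choose V hV using hvertex
  exact ⟨V, hV⟩

theorem exists_isCube (hq : q.IsOver P) (hV : ∀ i j, (V i j).path = q.path PathCell.bot i j) :
    ∃ S : Set (P.FarleyVertex w), IsCube 2 S ∧ ∀ i j, V i j ∈ S := by
  have hbot : labels (q.path PathCell.bot false false) = (V false false).bot := by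
    rw [← hV, FarleyVertex.labels_path]
  have hsteps := isDerivation_steps hq true true
  rw [hbot] at hsteps
  refine ⟨_, ⟨V false false, _, Diagram.ofDerivation hsteps,
    (isThin_steps hq).congr hbot rfl rfl, rfl, rfl⟩, fun i j => ?_⟩
  obtain ⟨l, hl⟩ := q.exists_isotopic_steps_append i j
  obtain ⟨v, hv, hv'⟩ := (hl.isDerivation_iff.1 hsteps).of_append
  exact ⟨v, Diagram.ofDerivation hv, ⟨Diagram.ofDerivation hv', Diagram.ofDerivation_eq_iff.2 hl⟩,
    FarleyVertex.isProduct_of_run_eq hv (by rw [hV, hV, run_steps PathCell.labels_bot])⟩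

end CellPair

namespace FarleyVertex

theorem areParallelSides_of_glues {S : Set (P.FarleyVertex w)} (hS : IsCube 2 S)
    {D D' E E' : P.FarleyVertex w} {c d : PathCell α} (hD : D ∈ S) (hE : E ∈ S) (hD' : D' ∈ S)
    (hE' : E' ∈ S) (h : P.Glues c D.path E.path) (h' : P.Glues c D'.path E'.path)
    (hDD' : P.Glues d D.path D'.path) (hEE' : P.Glues d E.path E'.path) :
    AreParallelSides ⟨s(D, E), adj_of_glues h⟩ ⟨s(D', E'), adj_of_glues h'⟩ := by
  have hnotMem : ∀ F ∈ s(D, E), d ∉ cells F.path := by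
    simp [hDD'.notMem_cells D.isSimple_path, hEE'.notMem_cells E.isSimple_path]
  have hmem : ∀ F ∈ s(D', E'), d ∈ cells F.path := by
    simp [hDD'.isExposed.mem_cells, hEE'.isExposed.mem_cells]
  exact ⟨S, hS, by simp [hD, hE], by simp [hD', hE'],
    fun F hF hF' => hnotMem F hF (hmem F hF')⟩

end FarleyVertex

namespace CellPair

variable {q : CellPair α} {D E : P.FarleyVertex w}

theorem exists_areParallelSides_left (hq : q.IsOver P)
    (hD : D.path = q.path PathCell.bot false true) (hE : E.path = q.path PathCell.bot true true)
    (h : P.Glues q.left D.path E.path) :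
    ∃ (D' E' : P.FarleyVertex w) (h' : P.Glues q.left D'.path E'.path),
      P.Glues q.right E'.path E.path ∧ AreParallelSides
        ⟨s(D', E'), FarleyVertex.adj_of_glues h'⟩ ⟨s(D, E), FarleyVertex.adj_of_glues h⟩ := by
  obtain ⟨V, hV⟩ := exists_vertices hq hE
  obtain rfl := FarleyVertex.path_injective (hD.trans (hV false true).symm)
  obtain rfl := FarleyVertex.path_injective (hE.trans (hV true true).symm)
  obtain ⟨S, hS, hVS⟩ := exists_isCube hq hV
  have hleft (j : Bool) : P.Glues q.left (V false j).path (V true j).path := by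
    simpa only [hV] using glues_left hq j
  have hright (i : Bool) : P.Glues q.right (V i false).path (V i true).path := by
    simpa only [hV] using glues_right hq i
  exact ⟨V false false, V true false, hleft false, hright true,
    FarleyVertex.areParallelSides_of_glues hS (hVS _ _) (hVS _ _) (hVS _ _) (hVS _ _) (hleft false)
      h (hright false) (hright true)⟩

theorem exists_areParallelSides_right (hq : q.IsOver P)
    (hD : D.path = q.path PathCell.bot true false) (hE : E.path = q.path PathCell.bot true true)
    (h : P.Glues q.right D.path E.path) :
    ∃ (D' E' : P.FarleyVertex w) (h' : P.Glues q.right D'.path E'.path),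
      P.Glues q.left E'.path E.path ∧ AreParallelSides
        ⟨s(D', E'), FarleyVertex.adj_of_glues h'⟩ ⟨s(D, E), FarleyVertex.adj_of_glues h⟩ := by
  obtain ⟨V, hV⟩ := exists_vertices hq hE
  obtain rfl := FarleyVertex.path_injective (hD.trans (hV true false).symm)
  obtain rfl := FarleyVertex.path_injective (hE.trans (hV true true).symm)
  obtain ⟨S, hS, hVS⟩ := exists_isCube hq hV
  have hleft (j : Bool) : P.Glues q.left (V false j).path (V true j).path := by
    simpa only [hV] using glues_left hq j
  have hright (i : Bool) : P.Glues q.right (V i false).path (V i true).path := by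
    simpa only [hV] using glues_right hq i
  exact ⟨V false false, V false true, hright false, hleft true,
    FarleyVertex.areParallelSides_of_glues hS (hVS _ _) (hVS _ _) (hVS _ _) (hVS _ _)
      (hright false) h (hleft false) (hleft true)⟩

end CellPair

theorem FarleyVertex.exists_areParallelSides_of_isExposed {D E : P.FarleyVertex w}
    {c d : PathCell α} (h : P.Glues c D.path E.path) (hd : d.IsExposed E.path) (hdc : d ≠ c) :
    ∃ (D' E' : P.FarleyVertex w) (h' : P.Glues c D'.path E'.path), P.Glues d E'.path E.path ∧
      AreParallelSides ⟨s(D', E'), adj_of_glues h'⟩ ⟨s(D, E), adj_of_glues h⟩ := by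
  obtain ⟨hc, x, y, hD, hE⟩ := id h
  obtain ⟨S, -, hd, x', y', -, hE'⟩ := hd.exists_glues E.isBotPath_path
  rcases segment_trichotomy hc.bot_ne_nil hd.bot_ne_nil (hE.symm.trans hE') with
    ⟨e, he, he'⟩ | ⟨z, rfl, rfl⟩ | ⟨z, rfl, rfl⟩
  · exact absurd (PathCell.eq_of_mem_bot he' he) hdc
  · exact CellPair.exists_areParallelSides_left (q := ⟨c, d, x, z, y'⟩) ⟨hc, hd⟩
      (by simpa [CellPair.path] using hD) hE' h
  · exact CellPair.exists_areParallelSides_right (q := ⟨d, c, x', z, y⟩) ⟨hd, hc⟩ hD hE h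

theorem exists_isExposed_ne_of_not_isTip {c : PathCell α} {S : EdgePath α} (hc : c ∈ cells S)
    (h : ¬ IsTip c S) : ∃ d : PathCell α, d.IsExposed S ∧ d ≠ c := by
  simpa [IsTip, hc] using h

namespace FarleyVertex

variable {c : PathCell α}

theorem exists_isTip_dual_eq {D E : P.FarleyVertex w} (h : P.Glues c D.path E.path) :
    ∃ (D' E' : P.FarleyVertex w) (h' : P.Glues c D'.path E'.path), IsTip c E'.path ∧
      Hyperplane.dual ⟨s(D, E), adj_of_glues h⟩ = Hyperplane.dual ⟨s(D', E'), adj_of_glues h'⟩ := by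
  induction E using glues_induction generalizing D with | _ E ih =>
  by_cases htip : IsTip c E.path
  · exact ⟨D, E, h, htip, rfl⟩
  obtain ⟨d, hd, hdc⟩ := exists_isExposed_ne_of_not_isTip h.isExposed.mem_cells htip
  obtain ⟨D₁, E₁, h₁, hglue, hparallel⟩ := exists_areParallelSides_of_isExposed h hd hdc
  obtain ⟨D', E', h', htip', hdual⟩ := ih E₁ d hglue h₁
  exact ⟨D', E', h', htip', (Quot.sound hparallel).symm.trans hdual⟩

theorem eq_of_glues {D D' E : P.FarleyVertex w} (h : P.Glues c D.path E.path)
    (h' : P.Glues c D'.path E.path) : D = D' :=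
  eq_of_cells_path_eq <| by
    rw [← Set.insert_sdiff_self_of_notMem (h.notMem_cells D.isSimple_path), ← h.cells_eq,
      h'.cells_eq, Set.insert_sdiff_self_of_notMem (h'.notMem_cells D'.isSimple_path)]

theorem mem_cells_induction {Δ : P.FarleyVertex w} (hΔ : IsTip c Δ.path)
    {p : P.FarleyVertex w → Prop} (tip : p Δ)
    (glue : ∀ D E d, d ≠ c → P.Glues d D.path E.path → p D → p E) {D : P.FarleyVertex w}
    (hD : c ∈ cells D.path) : p D := by
  induction D using glues_induction with | _ D ih =>
  by_cases htip : IsTip c D.path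
  · rwa [← path_injective (hΔ.unique htip Δ.isBotPath_path D.isBotPath_path)]
  obtain ⟨d, hd, hdc⟩ := exists_isExposed_ne_of_not_isTip hD htip
  obtain ⟨D₀, hglue⟩ := exists_glues_of_isExposed hd
  rw [hglue.cells_eq] at hD
  exact glue D₀ D d hdc hglue (ih D₀ d hglue (hD.resolve_left hdc.symm))

theorem notMem_cells_induction {p : P.FarleyVertex w → Prop} (base : p (base P w))
    (glue : ∀ D E d, d ≠ c → P.Glues d D.path E.path → p D → p E) {D : P.FarleyVertex w}
    (hD : c ∉ cells D.path) : p D := by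
  induction D using glues_induction with | _ D ih =>
  rcases (cells D.path).eq_empty_or_nonempty with hempty | ⟨e, he⟩
  · rwa [eq_of_cells_path_eq (D := D) (E := .base P w) (by simp [hempty])]
  obtain ⟨d, hd, -⟩ := D.isBotPath_path.exists_isExposed he
  obtain ⟨D₀, hglue⟩ := exists_glues_of_isExposed hd
  rw [hglue.cells_eq, Set.mem_insert_iff, not_or] at hD
  exact glue D₀ D d (Ne.symm hD.1) hglue (ih D₀ d hglue hD.2)

theorem mem_prefixCone_iff {Δ : P.FarleyVertex w} (hΔ : IsTip c Δ.path) {D : P.FarleyVertex w} :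
    D ∈ Δ.prefixCone ↔ c ∈ cells D.path := by
  refine ⟨fun h => Diagram.cells_botPath_subset h hΔ.1, fun h => ?_⟩
  refine mem_cells_induction hΔ (p := (· ∈ Δ.prefixCone)) ⟨_, (Diagram.comp_trivial _).symm⟩ ?_ h
  rintro D E d - hglue ⟨Γ, hΓ⟩
  obtain ⟨A, -, hA⟩ := exists_comp_eq_of_glues hglue
  exact ⟨Γ.comp A, by rw [hA, hΓ, Diagram.comp_assoc]⟩

theorem eq_of_prefixCone_eq {D E : P.FarleyVertex w} (h : D.prefixCone = E.prefixCone) :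
    D = E := by
  have hED : E ∈ D.prefixCone := h ▸ ⟨_, (Diagram.comp_trivial _).symm⟩
  have hDE : D ∈ E.prefixCone := h ▸ ⟨_, (Diagram.comp_trivial _).symm⟩
  exact eq_of_cells_path_eq
    ((Diagram.cells_botPath_subset hED).antisymm (Diagram.cells_botPath_subset hDE))

end FarleyVertex

/-! ### Hyperplanes -/

namespace Hyperplane

/-- The edges in `J` are the edges of `X(P, w)` that glue the cell `c`. -/
def IsDualTo (J : Hyperplane P w) (c : PathCell α) : Prop := ∀ e, e ∈ J.edges ↔ EdgeGlues e c

theorem dual_eq_of_edgeGlues {e f : (farleyGraph P w).edgeSet} {c : PathCell α}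
    (he : EdgeGlues e.1 c) (hf : EdgeGlues f.1 c) : dual e = dual f := by
  obtain ⟨_, _⟩ := e
  obtain ⟨_, _⟩ := f
  obtain ⟨D, E, rfl, h⟩ := he
  obtain ⟨D', E', rfl, h'⟩ := hf
  obtain ⟨D₁, E₁, h₁, htip, hdual⟩ := FarleyVertex.exists_isTip_dual_eq h
  obtain ⟨D₂, E₂, h₂, htip', hdual'⟩ := FarleyVertex.exists_isTip_dual_eq h'
  obtain rfl := FarleyVertex.path_injective
    (htip.unique htip' E₁.isBotPath_path E₂.isBotPath_path)
  obtain rfl := FarleyVertex.eq_of_glues h₁ h₂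
  exact hdual.trans hdual'.symm

theorem edgeGlues_iff_of_dual_eq {e f : (farleyGraph P w).edgeSet} (h : dual e = dual f)
    {c : PathCell α} : EdgeGlues e.1 c ↔ EdgeGlues f.1 c := by
  replace h := Quot.eqvGen_exact h
  induction h with
  | refl => rfl
  | symm _ _ _ ih => exact ih.symm
  | trans _ _ _ _ _ ih ih' => exact ih.trans ih'
  | rel e f h =>
    obtain ⟨c₁, h₁⟩ := exists_edgeGlues e.2
    obtain ⟨c₂, h₂⟩ := exists_edgeGlues f.2
    obtain rfl := h.eq_of_edgeGlues h₁ h₂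
    exact ⟨fun hc => hc.unique h₁ ▸ h₂, fun hc => hc.unique h₂ ▸ h₁⟩

theorem isDualTo_dual {e : (farleyGraph P w).edgeSet} {c : PathCell α} (he : EdgeGlues e.1 c) :
    (dual e).IsDualTo c := by
  refine fun f => ⟨fun ⟨hf, h⟩ => (edgeGlues_iff_of_dual_eq h).2 he, fun hf => ?_⟩
  obtain ⟨D, E, rfl, h⟩ := id hf
  exact ⟨FarleyVertex.adj_of_glues h, dual_eq_of_edgeGlues hf he⟩

namespace IsDualTo

variable {c : PathCell α} {J : Hyperplane P w} {D E Δ : P.FarleyVertex w}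

theorem adj_deleteEdges (hJ : J.IsDualTo c) {d : PathCell α} (hd : d ≠ c)
    (h : P.Glues d D.path E.path) : ((farleyGraph P w).deleteEdges J.edges).Adj D E := by
  rw [SimpleGraph.deleteEdges_adj, hJ]
  exact ⟨FarleyVertex.adj_of_glues h, fun h' => hd (EdgeGlues.unique ⟨D, E, rfl, h⟩ h')⟩

theorem reachable_of_mem_cells (hJ : J.IsDualTo c) (hΔ : IsTip c Δ.path) (hD : c ∈ cells D.path) :
    ((farleyGraph P w).deleteEdges J.edges).Reachable Δ D :=
  FarleyVertex.mem_cells_induction hΔ .rfl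
    (fun _ _ _ hd hglue h => h.trans (hJ.adj_deleteEdges hd hglue).reachable) hD

theorem reachable_base_of_notMem_cells (hJ : J.IsDualTo c) (hD : c ∉ cells D.path) :
    ((farleyGraph P w).deleteEdges J.edges).Reachable (FarleyVertex.base P w) D :=
  FarleyVertex.notMem_cells_induction .rfl
    (fun _ _ _ hd hglue h => h.trans (hJ.adj_deleteEdges hd hglue).reachable) hD

theorem mem_cells_of_reachable (hJ : J.IsDualTo c)
    (h : ((farleyGraph P w).deleteEdges J.edges).Reachable D E) (hc : c ∈ cells D.path) :
    c ∈ cells E.path := by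
  obtain ⟨p⟩ := h
  induction p with
  | nil => exact hc
  | @cons D E _ hadj _ ih =>
    refine ih ?_
    rw [SimpleGraph.deleteEdges_adj, hJ] at hadj
    obtain ⟨d, hglue | hglue⟩ := FarleyVertex.adj_iff.1 hadj.1
    · rw [hglue.cells_eq]
      exact .inr hc
    · rw [hglue.cells_eq] at hc
      refine hc.resolve_left ?_
      rintro rfl
      exact hadj.2 ⟨E, D, Sym2.eq_swap, hglue⟩

theorem supp_eq_prefixCone (hJ : J.IsDualTo c) (hΔ : IsTip c Δ.path) :
    (((farleyGraph P w).deleteEdges J.edges).connectedComponentMk Δ).supp = Δ.prefixCone := by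
  ext D
  rw [SimpleGraph.ConnectedComponent.mem_supp_iff, SimpleGraph.ConnectedComponent.eq,
    FarleyVertex.mem_prefixCone_iff hΔ]
  exact ⟨fun h => hJ.mem_cells_of_reachable h.symm hΔ.1,
    fun h => (hJ.reachable_of_mem_cells hΔ h).symm⟩

theorem isPositiveHalfspace_prefixCone (hJ : J.IsDualTo c) (hΔ : IsTip c Δ.path) :
    J.IsPositiveHalfspace Δ.prefixCone := by
  refine fun T => ⟨?_, ?_⟩
  · rintro ⟨⟨K, rfl⟩, hbase⟩
    induction K using SimpleGraph.ConnectedComponent.ind with | _ D =>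
    by_cases hc : c ∈ cells D.path
    · rw [← hJ.supp_eq_prefixCone hΔ,
        SimpleGraph.ConnectedComponent.eq.2 (hJ.reachable_of_mem_cells hΔ hc)]
    · exact absurd (SimpleGraph.ConnectedComponent.eq.2 (hJ.reachable_base_of_notMem_cells hc))
        hbase
  · rintro rfl
    exact ⟨⟨_, (hJ.supp_eq_prefixCone hΔ).symm⟩, by simp [FarleyVertex.mem_prefixCone_iff hΔ]⟩

theorem unique {K : Hyperplane P w} (hJ : J.IsDualTo c) (hK : K.IsDualTo c)
    (h : P.Glues c D.path E.path) : J = K := by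
  obtain ⟨_, hdual⟩ := (hJ s(D, E)).2 ⟨D, E, rfl, h⟩
  obtain ⟨_, hdual'⟩ := (hK s(D, E)).2 ⟨D, E, rfl, h⟩
  exact hdual.symm.trans hdual'

end IsDualTo

theorem IsPositiveHalfspace.unique {J : Hyperplane P w} {S T : Set (P.FarleyVertex w)}
    (hS : J.IsPositiveHalfspace S) (hT : J.IsPositiveHalfspace T) : S = T :=
  (hT S).1 ((hS S).2 rfl)

theorem exists_isDualTo_and_isTip (J : Hyperplane P w) :
    ∃ (c : PathCell α) (Δ : P.FarleyVertex w), J.IsDualTo c ∧ IsTip c Δ.path := by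
  induction J using Quot.ind with | mk e =>
  obtain ⟨c, hc⟩ := exists_edgeGlues e.2
  obtain ⟨D, E, -, h⟩ := id hc
  obtain ⟨-, Δ, -, hΔ, -⟩ := FarleyVertex.exists_isTip_dual_eq h
  exact ⟨c, Δ, isDualTo_dual hc, hΔ⟩

theorem existsUnique_isMinimal (J : Hyperplane P w) : ∃! Δ : P.FarleyVertex w,
    Δ.diagram.IsMinimal ∧ J.IsPositiveHalfspace Δ.prefixCone := by
  obtain ⟨c, Δ, hJ, hΔ⟩ := J.exists_isDualTo_and_isTip
  have hpos := hJ.isPositiveHalfspace_prefixCone hΔ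
  exact ⟨Δ, ⟨Diagram.isMinimal_of_isTip hΔ, hpos⟩,
    fun E hE => FarleyVertex.eq_of_prefixCone_eq (hE.2.unique hpos)⟩

theorem eq_of_isPositiveHalfspace {J K : Hyperplane P w} {S : Set (P.FarleyVertex w)}
    (hJ : J.IsPositiveHalfspace S) (hK : K.IsPositiveHalfspace S) : J = K := by
  obtain ⟨c, Δ, hJc, hΔ⟩ := J.exists_isDualTo_and_isTip
  obtain ⟨d, Δ', hKd, hΔ'⟩ := K.exists_isDualTo_and_isTip
  have hJΔ := hJ.unique (hJc.isPositiveHalfspace_prefixCone hΔ)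
  have hKΔ' := hK.unique (hKd.isPositiveHalfspace_prefixCone hΔ')
  obtain rfl := FarleyVertex.eq_of_prefixCone_eq (hJΔ.symm.trans hKΔ')
  have hexposed := hΔ.isExposed Δ.isBotPath_path
  obtain rfl := hΔ'.2 c hexposed
  obtain ⟨D, hglue⟩ := FarleyVertex.exists_glues_of_isExposed hexposed
  exact hJc.unique hKd hglue

end Hyperplane

theorem Diagram.IsMinimal.numCells_eq_one {u v x : List α} {Δ : P.Diagram u x}
    (hΔ : Δ.IsMinimal) {F : P.Diagram v x} (hF : F.IsMaximalThinSuffix Δ) : F.numCells = 1 := by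
  obtain ⟨v', F', hF', h1⟩ := hΔ
  obtain ⟨A, hA⟩ := hF.2.2 v' F' hF'.1 hF'.2.1
  obtain ⟨B, hB⟩ := hF'.2.2 v F hF.1 hF.2.1
  have hA' := congrArg numCells hA
  have hB' := congrArg numCells hB
  rw [numCells_comp] at hA' hB'
  omega

theorem FarleyVertex.isPositiveHalfspace_of_isMaximalThinSuffix {Δ : P.FarleyVertex w}
    (hΔ : Δ.diagram.IsMinimal) {v : List α} {F : P.Diagram v Δ.bot}
    (hF : F.IsMaximalThinSuffix Δ.diagram) {E : P.FarleyVertex w} (hE : Δ.IsProduct F.inv E) :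
    ∃ h : s(Δ, E) ∈ (P.farleyGraph w).edgeSet,
      (Hyperplane.dual ⟨s(Δ, E), h⟩).IsPositiveHalfspace Δ.prefixCone := by
  obtain ⟨c, htip, hglues⟩ := exists_isTip_of_isMaximalThinSuffix hF (hΔ.numCells_eq_one hF)
  have hglue := hglues E hE
  exact ⟨(adj_of_glues hglue).symm, (Hyperplane.isDualTo_dual
    ⟨E, Δ, Sym2.eq_swap, hglue⟩).isPositiveHalfspace_prefixCone htip⟩

theorem Hyperplane.exists_isPositiveHalfspace_prefixCone {Δ : P.FarleyVertex w}
    (hΔ : Δ.diagram.IsMinimal) : ∃ J : Hyperplane P w, J.IsPositiveHalfspace Δ.prefixCone := by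
  obtain ⟨v, F, hF, -⟩ := id hΔ
  obtain ⟨E, hE⟩ := Δ.exists_isProduct F.inv
  obtain ⟨h, hJ⟩ := FarleyVertex.isPositiveHalfspace_of_isMaximalThinSuffix hΔ hF hE
  exact ⟨_, hJ⟩

end SemigroupPresentation

theorem proposition2p2 {α : Type*} (P : SemigroupPresentation α) (w : List α) (hw : w ≠ []) :
    -- every hyperplane `J` has a unique minimal diagram `Δ` with `J⁺ = {D | Δ ≤ D}`
    (∀ J : P.Hyperplane w, ∃! Δ : P.FarleyVertex w,
      Δ.diagram.IsMinimal ∧ J.IsPositiveHalfspace Δ.prefixCone) ∧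
    -- conversely, if `Δ` is minimal with maximal thin suffix `F`, then `E = Δ · F⁻¹` is adjacent to
    -- `Δ`, and the hyperplane `J` dual to the edge `[Δ, E]` satisfies `J⁺ = {D | Δ ≤ D}`
    (∀ Δ : P.FarleyVertex w, Δ.diagram.IsMinimal →
      ∀ (v : List α) (F : P.Diagram v Δ.bot), F.IsMaximalThinSuffix Δ.diagram →
        (∃ E : P.FarleyVertex w, Δ.IsProduct F.inv E) ∧
        ∀ E : P.FarleyVertex w, Δ.IsProduct F.inv E →
          ∃ h : s(Δ, E) ∈ (P.farleyGraph w).edgeSet,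
            (SemigroupPresentation.Hyperplane.dual ⟨s(Δ, E), h⟩).IsPositiveHalfspace Δ.prefixCone) ∧
    -- hence hyperplanes and minimal diagrams are in bijection
    (∃ Φ : P.Hyperplane w ≃ {Δ : P.FarleyVertex w // Δ.diagram.IsMinimal},
      ∀ J : P.Hyperplane w, J.IsPositiveHalfspace (Φ J).1.prefixCone) := by
  refine ⟨fun J => J.existsUnique_isMinimal, fun Δ hΔ v F hF =>
    ⟨Δ.exists_isProduct F.inv, fun E hE =>
      SemigroupPresentation.FarleyVertex.isPositiveHalfspace_of_isMaximalThinSuffix hΔ hF hE⟩, ?_⟩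
  choose φ hφ _ using fun J : P.Hyperplane w => J.existsUnique_isMinimal
  refine ⟨Equiv.ofBijective (fun J => ⟨φ J, (hφ J).1⟩) ⟨fun J K hJK => ?_, fun ⟨Δ, hΔ⟩ => ?_⟩,
    fun J => (hφ J).2⟩
  · have hφJK : φ J = φ K := congrArg Subtype.val hJK
    exact SemigroupPresentation.Hyperplane.eq_of_isPositiveHalfspace (hφ J).2 (hφJK ▸ (hφ K).2)
  · obtain ⟨J, hJ⟩ := SemigroupPresentation.Hyperplane.exists_isPositiveHalfspace_prefixCone hΔ
    exact ⟨J, Subtype.ext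
      (SemigroupPresentation.FarleyVertex.eq_of_prefixCone_eq ((hφ J).2.unique hJ))⟩
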